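/- For $j=1,2$ let $Y_{jt}=\mu_j+u_{jt}$, $t=1,\dots,T_j$, where the error processes $\{u_{1t}\}_{t\in\mathbb Z}$ and $\{u_{2t}\}_{t\in\mathbb Z}$ are independent of each other, and let $\bar Y_j=T_j^{-1}\sum_{t=1}^{T_j}Y_{jt}$. Assume: (a) The long-run variances $\Omega_j=\lim_{T_j\to\infty}\mathrm{Var}\big(\sqrt{T_j}(\bar Y_j-\mu_j)\big)$ exist and satisfy $0<\Omega_j<\infty$, and with $u_t=(u_{1t},u_{2t})'$ the functional central limit theorem $$\frac1{\sqrt T}\sum_{t=1}^{\lfloor rT\rfloor}u_t\ \to^d\ \mathrm{diag}\big(\sqrt{\Omega_1},\sqrt{\Omega_2}\big)\,W(r)$$ holds in $D([0,1],\mathbb R^2)$ as $T\to\infty$, where $W$ is a two-dimensional standard Brownian motion. (b) Each $\{u_{jt}\}$ has mean zero and finite fourth moments and is fourth-order stationary (its joint moments up to order four are invariant under time shifts). With $\gamma_j(h)=E[u_{jt}u_{j,t+h}]$ and $\kappa_j(0,h_1,h_2,h_3)$ the joint fourth-order cumulant of $(u_{jt},u_{j,t+h_1},u_{j,t+h_2},u_{j,t+h_3})$,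 one has $\sum_{h\in\mathbb Z}|h|^3|\gamma_j(h)|<\infty$ and $\sum_{h_1,h_2,h_3\in\mathbb Z}|\kappa_j(0,h_1,h_2,h_3)|<\infty$. (c) The series-HAR wild bootstrap is given by $$Y^*_{jt}=\mu^*+\hat u_{jt}\,\eta_{jt},\qquad \mu^*=\frac{T_1\bar Y_1+T_2\bar Y_2}{T_1+T_2},\qquad \hat u_{jt}=Y_{jt}-\bar Y_j,\qquad \bar Y^*_j=\frac1{T_j}\sum_{t=1}^{T_j}Y^*_{jt},$$ $$\eta_{jt}=\frac1{\sqrt{K_j^*}}\sum_{\ell=1}^{K_j^*}\Big[\cos\!\big(2\pi\ell\tfrac t{T_j}\big)v_{j,1\ell}+\sin\!\big(2\pi\ell\tfrac t{T_j}\big)v_{j,2\ell}\Big],$$ where, for each $j$ and each sample size, the weights $v_{j,r\ell}$ ($r=1,2$, $1\le\ell\le K_j^*$) are i.i.d. with mean $0$ and variance $1$, are independent of the data, and satisfy $E\,v_{j,r\ell}^4<C$ for a constant $C<\infty$ that does not depend on the sample size. Let $P^*$ denote the conditional probability given the data $\{Y_{jt}:1\le t\le T_j,\ j=1,2\}$.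 If for $j=1,2$ one has $T_j\to\infty$, $K_j^*\to\infty$ and $K_j^*/T_j\to0$, then for each $j=1,2$ $$\sup_{x\in\mathbb R}\Big|P^*\big(\sqrt{T_j}(\bar Y^*_j-\mu^*)<x\big)-P\big(\sqrt{T_j}(\bar Y_j-\mu_j)<x\big)\Big|\ \to\ 0\quad\text{in probability}.$$ -/

import Mathlib

open MeasureTheory ProbabilityTheory Filter Topology
open scoped NNReal

noncomputable section

namespace SeriesHAR

/-! ### Fourth-order stationary processes, cumulants, long-run variance -/

section Processes

variable {Ω : Type*} [MeasurableSpace Ω]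

/-- Fourth-order stationarity: finite fourth moments, and all joint moments of order at most four
are invariant under time shifts. -/
structure IsFourthOrderStationary (X : ℤ → Ω → ℝ) (P : Measure Ω) : Prop where
  memLp : ∀ t, MemLp (X t) 4 P
  shift : ∀ k : ℕ, k ≤ 4 → ∀ (s : Fin k → ℤ) (h : ℤ),
    ∫ ω, ∏ i, X (s i + h) ω ∂P = ∫ ω, ∏ i, X (s i) ω ∂P

/-- The autocovariance `γ(h) = E[X_0 X_h]` of a mean-zero process. -/
def autocov (X : ℤ → Ω → ℝ) (P : Measure Ω) (h : ℤ) : ℝ :=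
  ∫ ω, X 0 ω * X h ω ∂P

/-- The joint fourth-order cumulant of four random variables: the fourth mixed central moment minus
the value it takes for a Gaussian vector with the same mean and covariances. -/
def cumulant₄ (A B C D : Ω → ℝ) (P : Measure Ω) : ℝ :=
  ∫ ω, (A ω - ∫ ω', A ω' ∂P) * (B ω - ∫ ω', B ω' ∂P)
      * (C ω - ∫ ω', C ω' ∂P) * (D ω - ∫ ω', D ω' ∂P) ∂P
    - (cov[A, B; P] * cov[C, D; P] + cov[A, C; P] * cov[B, D; P] + cov[A, D; P] * cov[B, C; P])

/-- Mean zero, fourth-order stationary, `∑_h |h|³ |γ(h)| < ∞`, and absolutely summable fourth-order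
cumulants `κ(0, h₁, h₂, h₃)`. -/
structure WeakDependence (X : ℤ → Ω → ℝ) (P : Measure Ω) : Prop where
  stationary : IsFourthOrderStationary X P
  mean_zero : ∀ t, ∫ ω, X t ω ∂P = 0
  summable_autocov : Summable fun h : ℤ => |(h : ℝ)| ^ 3 * |autocov X P h|
  summable_cumulant : Summable fun h : ℤ × ℤ × ℤ =>
    |cumulant₄ (X 0) (X h.1) (X h.2.1) (X h.2.2) P|

end Processes

/-- The sample mean of `y 1, …, y T`. -/
def sampleMean (T : ℕ) (y : ℕ → ℝ) : ℝ :=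
  (∑ t ∈ Finset.Icc 1 T, y t) / T

/-- `Ω₀` is the long-run variance of the series `y_t` with mean `m`:
`Var(√T (ȳ_T - m)) → Ω₀` as `T → ∞`. -/
def IsLongRunVariance {Ω : Type*} [MeasurableSpace Ω] (y : ℕ → Ω → ℝ) (m : ℝ) (P : Measure Ω)
    (Ω₀ : ℝ) : Prop :=
  Tendsto (fun T : ℕ => Var[fun ω => √(T : ℝ) * (sampleMean T (fun t => y t ω) - m); P])
    atTop (𝓝 Ω₀)

/-! ### Weak convergence in the Skorokhod space `D([0,1], ℝ²)` -/

/-- Right-continuous paths with left limits on `[0,1]`. -/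
def IsCadlag (x : unitInterval → Fin 2 → ℝ) : Prop :=
  ∀ r, ContinuousWithinAt x (Set.Ioi r) r ∧ ∃ l, Tendsto x (𝓝[<] r) (𝓝 l)

/-- Convergence of a sequence of paths in Skorokhod's `J₁` topology: there are increasing
bijections `τ n` of `[0,1]` with `sup_r |τ n r - r| → 0` and `sup_r |x n (τ n r) - x₀ r| → 0`. -/
def SkorokhodTendsto (x : ℕ → unitInterval → Fin 2 → ℝ) (x₀ : unitInterval → Fin 2 → ℝ) : Prop :=
  ∃ τ : ℕ → (unitInterval ≃o unitInterval),
    TendstoUniformly (fun n r => τ n r) (fun r => r) atTop ∧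
    TendstoUniformly (fun n r => x n (τ n r)) x₀ atTop

/-- Bounded functionals that are continuous on `D([0,1], ℝ²)` for the `J₁` topology. That topology
is metrizable, so sequential continuity is continuity. -/
structure IsSkorokhodTestFunction (F : (unitInterval → Fin 2 → ℝ) → ℝ) : Prop where
  bounded : ∃ M : ℝ, ∀ x, |F x| ≤ M
  continuous : ∀ (x : ℕ → unitInterval → Fin 2 → ℝ) (x₀ : unitInterval → Fin 2 → ℝ),
    (∀ n, IsCadlag (x n)) → IsCadlag x₀ → SkorokhodTendsto x x₀ →
      Tendsto (fun n => F (x n)) atTop (𝓝 (F x₀))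

/-- The partial-sum process `r ↦ T^{-1/2} ∑_{1 ≤ t ≤ ⌊rT⌋} u_t` on `[0,1]`. -/
def partialSumProcess {Ω : Type*} (u : Fin 2 → ℤ → Ω → ℝ) (T : ℕ) (ω : Ω) :
    unitInterval → Fin 2 → ℝ :=
  fun r i => (∑ t ∈ Finset.Icc 1 ⌊(r : ℝ) * T⌋₊, u i (t : ℤ) ω) / √(T : ℝ)

/-- The two-dimensional standard Brownian motion: two independent real Brownian motions. -/
structure IsStandardBrownian₂ {Ω' : Type*} [MeasurableSpace Ω'] (W : Fin 2 → ℝ≥0 → Ω' → ℝ)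
    (P' : Measure Ω') : Prop where
  isBrownian : ∀ i, IsBrownianReal (W i) P'
  indep : iIndepFun (fun i ω r => W i r ω) P'

/-- The path `r ↦ diag(√Ω₁, √Ω₂) W(r)` on `[0,1]`. -/
def scaledBrownianPath {Ω' : Type*} (LRV : Fin 2 → ℝ) (W : Fin 2 → ℝ≥0 → Ω' → ℝ) (ω : Ω') :
    unitInterval → Fin 2 → ℝ :=
  fun r i => √(LRV i) * W i (unitInterval.toNNReal r) ω

/-- The functional central limit theorem for `u_t = (u_{1t}, u_{2t})`: the partial-sum processes
converge weakly in `D([0,1], ℝ²)` to `diag(√Ω₁, √Ω₂) W`. -/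
def FunctionalCLT {Ω Ω' : Type*} [MeasurableSpace Ω] [MeasurableSpace Ω']
    (u : Fin 2 → ℤ → Ω → ℝ) (P : Measure Ω) (LRV : Fin 2 → ℝ)
    (W : Fin 2 → ℝ≥0 → Ω' → ℝ) (P' : Measure Ω') : Prop :=
  ∀ F : (unitInterval → Fin 2 → ℝ) → ℝ, IsSkorokhodTestFunction F →
    Tendsto (fun T : ℕ => ∫ ω, F (partialSumProcess u T ω) ∂P) atTop
      (𝓝 (∫ ω', F (scaledBrownianPath LRV W ω') ∂P'))

/-! ### The series HAR wild bootstrap -/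

/-- The external variable
`η_t = K^{-1/2} ∑_{ℓ=1}^K [cos(2πℓ t/T) v_{1ℓ} + sin(2πℓ t/T) v_{2ℓ}]`; the index `ℓ : Fin K` stands
for the frequency `ℓ + 1`, and the first index `0`, `1` of `v` for the cosine and the sine. -/
def externalVar (T K : ℕ) (v : Fin 2 × Fin K → ℝ) (t : ℕ) : ℝ :=
  1 / √(K : ℝ) * ∑ ℓ : Fin K,
    (Real.cos (2 * Real.pi * ((ℓ : ℝ) + 1) * ((t : ℝ) / T)) * v (0, ℓ)
      + Real.sin (2 * Real.pi * ((ℓ : ℝ) + 1) * ((t : ℝ) / T)) * v (1, ℓ))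

/-- The pooled mean `μ* = (T₁ Ȳ₁ + T₂ Ȳ₂) / (T₁ + T₂)`. -/
def pooledMean (T : Fin 2 → ℕ) (y : Fin 2 → ℕ → ℝ) : ℝ :=
  (T 0 * sampleMean (T 0) (y 0) + T 1 * sampleMean (T 1) (y 1)) / (T 0 + T 1)

/-- The bootstrap observation `Y*_{jt} = μ* + (Y_{jt} - Ȳ_j) η_{jt}`. -/
def bootstrapObs (T : Fin 2 → ℕ) (y : Fin 2 → ℕ → ℝ) (j : Fin 2) (K : ℕ) (v : Fin 2 × Fin K → ℝ)
    (t : ℕ) : ℝ :=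
  pooledMean T y + (y j t - sampleMean (T j) (y j)) * externalVar (T j) K v t

/-- The bootstrap statistic `√T_j (Ȳ*_j - μ*)`. -/
def bootstrapStat (T : Fin 2 → ℕ) (y : Fin 2 → ℕ → ℝ) (j : Fin 2) (K : ℕ)
    (v : Fin 2 × Fin K → ℝ) : ℝ :=
  √(T j : ℝ) * (sampleMean (T j) (bootstrapObs T y j K v) - pooledMean T y)

/-- The original sample `(Y_{jt} : 1 ≤ t ≤ T_j, j = 1, 2)` as a random element. -/
def dataSample {Ω : Type*} (T : Fin 2 → ℕ) (Y : Fin 2 → ℕ → Ω → ℝ) (ω : Ω) :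
    (i : Fin 2) → Fin (T i) → ℝ :=
  fun i t => Y i ((t : ℕ) + 1) ω

end SeriesHAR

end

noncomputable section

namespace SeriesHAR

/-! Given the data, the bootstrap statistic is linear in the external weights:
`bootstrapStat_eq_sum` writes it as `∑ c_i v_i`, where `c_i` is `K^{-1/2}` times a cosine or sine
transform of the demeaned series. A Lyapunov central limit theorem puts its conditional law near
`N(0, Ω_j)` as soon as `∑ c_i²` is near `Ω_j` and `∑ c_i⁴` is small. `exists_weightedSum_approx`
makes this uniform in the coefficients, so both conditions need only hold with high probability over
the data.

The coefficients are controlled by moments. At Fourier frequencies demeaning has no effect, and the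
scaled cosines and sines are orthogonal with squared norm `1/2` (`sum_scaledBasis_mul`). Since `cos
cos + sin sin` depends only on the lag, the mean of `∑ c_i²` differs from `Var(√T Ȳ)` by `O(K/T)`,
and that variance tends to `Ω_j`. For the fluctuations, fourth moments split into a Gaussian part
and a cumulant part. Bessel's inequality, together with the boundedness of the covariance operator,
makes the sum of all `(2K)²` squared covariances only `O(K)`, hence `O(1/K)` after normalization;
the cumulants contribute `O(1/T)` (`WeakDependence.integral_bootVariance_sub_sq_le`). The same
moment formula gives `E ∑ c_i⁴ = O(1/K)`.

The true law has the same limit `N(0, Ω_j)`, by evaluating the functional limit theorem at `r = 1`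
(`tendstoUniformly_sampleMean`). The limit has no atoms because `Ω_j > 0`, so Pólya's theorem makes
both comparisons uniform in `x`. -/

/-! ### Pólya's theorem: convergence of distribution functions is uniform -/

/-- Distribution functions converging pointwise to a continuous one converge uniformly. -/
lemma tendstoUniformly_of_monotone {F : ℕ → ℝ → ℝ} {G : ℝ → ℝ} (hF : ∀ n, Monotone (F n))
    (hG : Monotone G) (hGc : Continuous G) (hF0 : ∀ n x, 0 ≤ F n x) (hF1 : ∀ n x, F n x ≤ 1)
    (hG0 : Tendsto G atBot (𝓝 0)) (hG1 : Tendsto G atTop (𝓝 1))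
    (hlim : ∀ x, Tendsto (fun n => F n x) atTop (𝓝 (G x))) :
    TendstoUniformly F G atTop := by
  have hGnn : ∀ x, 0 ≤ G x := fun x => ge_of_tendsto' (hlim x) fun n => hF0 n x
  have hGle : ∀ x, G x ≤ 1 := fun x => le_of_tendsto' (hlim x) fun n => hF1 n x
  rw [Metric.tendstoUniformly_iff]
  intro ε hε
  have near : ∀ x, ∀ᶠ n in atTop, |F n x - G x| < ε / 2 := fun x => by
    simpa [Real.dist_eq] using (Metric.tendsto_nhds.1 (hlim x) (ε / 2) (by positivity))
  -- Outside `[A, B]` the limit is within `ε/2` of `0` or `1`, and monotonicity carries the control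
  -- at `A` and `B` into the tails.
  obtain ⟨A, hA⟩ := (hG0.eventually (gt_mem_nhds (show (0 : ℝ) < ε / 2 by positivity))).exists
  obtain ⟨B, hB⟩ := (hG1.eventually
    (lt_mem_nhds (show (1 : ℝ) - ε / 2 < 1 by linarith))).exists
  have mid : TendstoUniformlyOn F G atTop (Set.Icc A B) := by
    rw [← tendstoLocallyUniformlyOn_iff_tendstoUniformlyOn_of_compact isCompact_Icc,
      Metric.tendstoLocallyUniformlyOn_iff]
    intro δ hδ x _
    obtain ⟨r, hr, hrG⟩ := Metric.continuousAt_iff.1 (hGc.continuousAt (x := x)) (δ / 4)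
      (by positivity)
    have hl := hrG (x := x - r / 2) (by simp [abs_of_pos hr]; linarith)
    have hu := hrG (x := x + r / 2) (by simp [abs_of_pos hr]; linarith)
    -- On a short interval monotonicity sandwiches both functions between their values at its
    -- endpoints. Convergence there and two oscillation bounds for `G` cost at most `3δ/4`.
    rw [Real.dist_eq, abs_lt] at hl hu
    refine ⟨Set.Icc (x - r / 2) (x + r / 2),
      mem_nhdsWithin_of_mem_nhds (Icc_mem_nhds (by linarith) (by linarith)), ?_⟩
    filter_upwards [Metric.tendsto_nhds.1 (hlim (x - r / 2)) (δ / 4) (by positivity),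
      Metric.tendsto_nhds.1 (hlim (x + r / 2)) (δ / 4) (by positivity)] with n h1 h2 y hy
    rw [Real.dist_eq, abs_lt] at h1 h2
    rw [Real.dist_eq, abs_lt]
    have := hF n hy.1
    have := hF n hy.2
    have := hG hy.1
    have := hG hy.2
    constructor <;> linarith
  rw [Metric.tendstoUniformlyOn_iff] at mid
  filter_upwards [mid ε hε, near A, near B] with n h1 h2 h3 x
  rw [abs_lt] at h2 h3
  rcases lt_or_ge x A with hx | hx
  · have := hF n hx.le
    have := hG hx.le
    have := hF0 n x
    have := hGnn x
    rw [Real.dist_eq, abs_lt]; constructor <;> linarith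
  rcases lt_or_ge B x with hx' | hx'
  · have := hF n hx'.le
    have := hG hx'.le
    have := hF1 n x
    have := hGle x
    rw [Real.dist_eq, abs_lt]; constructor <;> linarith
  exact h1 x ⟨hx, hx'⟩

lemma measureReal_Iio_eq_cdf (ν : Measure ℝ) [IsProbabilityMeasure ν] [NullSingletonClass ν] (x : ℝ) :
    ν.real (Set.Iio x) = cdf ν x := by
  rw [cdf_eq_real]
  exact measureReal_congr Iio_ae_eq_Iic

/-- The jump of a distribution function at a point is the mass of that point. -/
lemma continuous_cdf_of_noAtoms (ν : Measure ℝ) [IsProbabilityMeasure ν] [NullSingletonClass ν] :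
    Continuous (cdf ν) := by
  refine continuous_iff_continuousAt.2 fun x => ?_
  rw [(monotone_cdf ν).continuousAt_iff_leftLim_eq_rightLim, (cdf ν).rightLim_eq]
  refine le_antisymm ((monotone_cdf ν).leftLim_le le_rfl) ?_
  have h : (cdf ν).measure {x} = 0 := by rw [measure_cdf]; exact measure_singleton x
  rw [StieltjesFunction.measure_singleton, ENNReal.ofReal_eq_zero] at h
  linarith

/-- Weak convergence to an atomless law implies uniform convergence of the distribution
functions. -/
lemma tendstoUniformly_measureReal_Iio {μ : ℕ → ProbabilityMeasure ℝ} {ν : ProbabilityMeasure ℝ}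
    (hν : NullSingletonClass (ν : Measure ℝ)) (h : Tendsto μ atTop (𝓝 ν)) :
    TendstoUniformly (fun n x => (μ n : Measure ℝ).real (Set.Iio x))
      (fun x => (ν : Measure ℝ).real (Set.Iio x)) atTop := by
  have key : (fun x => (ν : Measure ℝ).real (Set.Iio x)) = cdf (ν : Measure ℝ) :=
    funext (measureReal_Iio_eq_cdf _)
  refine tendstoUniformly_of_monotone (fun n x y hxy => measureReal_mono (Set.Iio_subset_Iio hxy))
    (fun x y hxy => measureReal_mono (Set.Iio_subset_Iio hxy)) ?_ (fun _ _ => measureReal_nonneg)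
    (fun _ _ => measureReal_le_one) ?_ ?_ fun x => ?_
  · rw [key]; exact continuous_cdf_of_noAtoms _
  · rw [key]; exact tendsto_cdf_atBot _
  · rw [key]; exact tendsto_cdf_atTop _
  · refine (ENNReal.tendsto_toReal (measure_ne_top _ _)).comp
      (ProbabilityMeasure.tendsto_measure_of_null_frontier_of_tendsto' h ?_)
    rw [frontier_Iio]
    exact measure_singleton x

/-! ### A central limit theorem for weighted sums -/

/-- For `|x| ≤ 1` this is the Taylor remainder. For `|x| > 1` every term is dominated by `|x|³`,
with total constant `7/2`, which the constant `4` covers. -/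
lemma norm_exp_mul_I_sub_taylor_le (x : ℝ) :
    ‖Complex.exp (x * Complex.I) - (1 + x * Complex.I - x ^ 2 / 2)‖ ≤ 4 * |x| ^ 3 := by
  rcases le_or_gt |x| 1 with hx | hx
  · have h := Complex.exp_bound (x := x * Complex.I) (by simpa using hx) (n := 3) (by norm_num)
    have e : ∑ m ∈ Finset.range 3, (x * Complex.I) ^ m / (m.factorial : ℂ)
        = 1 + x * Complex.I - x ^ 2 / 2 := by
      simp [Finset.sum_range_succ, mul_pow, Complex.I_sq]; ring
    rw [e] at h
    refine h.trans ?_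
    have : ‖(x : ℂ) * Complex.I‖ = |x| := by simp
    rw [this]
    have : (0 : ℝ) ≤ |x| ^ 3 := by positivity
    norm_num [Nat.factorial]
    linarith
  · have h1 : ‖Complex.exp (x * Complex.I)‖ = 1 := Complex.norm_exp_ofReal_mul_I x
    have h2 : ‖(1 + x * Complex.I - x ^ 2 / 2 : ℂ)‖ ≤ 1 + |x| + |x| ^ 2 / 2 := by
      refine (norm_sub_le _ _).trans (add_le_add ((norm_add_le _ _).trans ?_) ?_)
      · simp
      · simp
    have h3 := norm_sub_le (Complex.exp (x * Complex.I)) (1 + x * Complex.I - x ^ 2 / 2)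
    have h4 : |x| ≤ |x| ^ 3 := le_self_pow₀ hx.le (by norm_num)
    have h5 : |x| ^ 2 ≤ |x| ^ 3 := pow_le_pow_right₀ hx.le (by norm_num)
    nlinarith

/-- Trades the third absolute moment in the Taylor remainder for the fourth moment that is assumed
bounded. -/
lemma abs_cube_le (x : ℝ) : |x| ^ 3 ≤ 1 + x ^ 4 := by
  rw [← Even.pow_abs (show Even 4 by decide) x]
  rcases le_or_gt |x| 1 with hx | hx
  · have := pow_le_one₀ (abs_nonneg x) hx (n := 3)
    have : 0 ≤ |x| ^ (4) := by positivity
    linarith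
  · have := pow_le_pow_right₀ hx.le (show 3 ≤ 4 by norm_num)
    linarith

lemma integrable_pow_four {Ω : Type*} [MeasurableSpace Ω] {P : Measure Ω} {V : Ω → ℝ}
    (hV : MemLp V 4 P) : Integrable (fun ω => V ω ^ 4) P := by
  have := hV.integrable_norm_pow (p := 4) (by norm_num)
  simpa [Even.pow_abs (show Even 4 by decide)] using this

section CLT

variable {Ω : Type*} [MeasurableSpace Ω] {P : Measure Ω} [IsProbabilityMeasure P]

/-- Second-order expansion of the characteristic function of a standardized variable with a finite
fourth moment. -/
lemma norm_charFun_sub_taylor_le {V : Ω → ℝ} (hV : Measurable V) (h4 : MemLp V 4 P)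
    (hmean : ∫ ω, V ω ∂P = 0) (hvar : Var[V; P] = 1) {C : ℝ} (hC : ∫ ω, V ω ^ 4 ∂P ≤ C) (s : ℝ) :
    ‖charFun (P.map V) s - (1 - s ^ 2 / 2)‖ ≤ 4 * (1 + C) * |s| ^ 3 := by
  have i1 : Integrable V P := h4.integrable (by norm_num)
  have i2 : Integrable (fun ω => V ω ^ 2) P :=
    (h4.mono_exponent (by norm_num : (2 : ENNReal) ≤ 4)).integrable_sq
  have i4 := integrable_pow_four h4
  have v2 : ∫ ω, V ω ^ 2 ∂P = 1 := by
    rw [← hvar, variance_of_integral_eq_zero hV.aemeasurable hmean]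
  have j1 : Integrable (fun ω => 1 - s ^ 2 / 2 * V ω ^ 2) P :=
    (integrable_const _).sub (i2.const_mul _)
  have j2 : Integrable (fun ω => s * V ω) P := i1.const_mul s
  have k1 : Integrable (fun ω => ((1 - s ^ 2 / 2 * V ω ^ 2 : ℝ) : ℂ)) P := j1.ofReal
  have k2 : Integrable (fun ω => ((s * V ω : ℝ) : ℂ) * Complex.I) P := j2.ofReal.mul_const _
  have hpoly : ∫ ω, (((1 - s ^ 2 / 2 * V ω ^ 2 : ℝ) : ℂ) + ((s * V ω : ℝ) : ℂ) * Complex.I) ∂P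
      = 1 - (s : ℂ) ^ 2 / 2 := by
    rw [integral_add k1 k2, integral_mul_const, integral_complex_ofReal,
      integral_complex_ofReal,
      integral_const_mul, hmean, integral_sub (integrable_const _) (i2.const_mul _),
      integral_const_mul, v2]
    simp
  have hchar : charFun (P.map V) s = ∫ ω, Complex.exp ((s * V ω : ℝ) * Complex.I) ∂P := by
    rw [charFun_apply_real, integral_map hV.aemeasurable (by fun_prop)]
    simp
  have ie : Integrable (fun ω => Complex.exp ((s * V ω : ℝ) * Complex.I)) P := by
    refine Integrable.of_bound (by fun_prop) 1 (Eventually.of_forall fun ω => ?_)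
    rw [Complex.norm_exp_ofReal_mul_I]
  have hsub := integral_sub ie (k1.add k2)
  simp only [Pi.add_apply] at hsub
  rw [hchar, ← hpoly, ← hsub]
  refine (norm_integral_le_of_norm_le (g := fun ω => 4 * |s| ^ 3 * (1 + V ω ^ 4))
    (((integrable_const _).add i4).const_mul _) (Eventually.of_forall fun ω => ?_)).trans ?_
  · have e : ((1 - s ^ 2 / 2 * V ω ^ 2 : ℝ) : ℂ) + ((s * V ω : ℝ) : ℂ) * Complex.I
        = 1 + (s * V ω : ℝ) * Complex.I - ((s * V ω : ℝ) : ℂ) ^ 2 / 2 := by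
      push_cast; ring
    rw [e]
    refine (norm_exp_mul_I_sub_taylor_le _).trans ?_
    rw [abs_mul, mul_pow]
    have := mul_le_mul_of_nonneg_left (abs_cube_le (V ω)) (show 0 ≤ |s| ^ 3 by positivity)
    linarith
  · rw [integral_const_mul, integral_add (integrable_const _) i4]
    have h0 : 0 ≤ |s| ^ 3 := by positivity
    simp only [integral_const, probReal_univ, one_smul]
    nlinarith

lemma abs_exp_neg_sub_le {y : ℝ} (hy : 0 ≤ y) : |Real.exp (-y) - (1 - y)| ≤ y ^ 2 := by
  have h1 := Real.add_one_le_exp (-y)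
  rw [abs_of_nonneg (by linarith)]
  have h2 := Real.add_one_le_exp y
  have h3 : Real.exp (-y) ≤ 1 / (1 + y) := by
    rw [Real.exp_neg, inv_eq_one_div]
    exact one_div_le_one_div_of_le (by linarith) (by linarith)
  have h4 : 1 / (1 + y) ≤ 1 - y + y ^ 2 := by
    rw [div_le_iff₀ (by linarith)]
    nlinarith [pow_nonneg hy 3]
  linarith

/-- Both characteristic functions are compared with their common second-order expansion `1 - s²/2`.
-/
lemma norm_charFun_sub_gaussian_le {V : Ω → ℝ} (hV : Measurable V) (h4 : MemLp V 4 P)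
    (hmean : ∫ ω, V ω ∂P = 0) (hvar : Var[V; P] = 1) {C : ℝ} (hC : ∫ ω, V ω ^ 4 ∂P ≤ C) (s : ℝ) :
    ‖charFun (P.map V) s - Complex.exp (-(s ^ 2 / 2 : ℝ))‖
      ≤ 4 * (1 + C) * |s| ^ 3 + s ^ 4 := by
  have h1 := norm_charFun_sub_taylor_le hV h4 hmean hvar hC s
  have h2 : ‖Complex.exp (-(s ^ 2 / 2 : ℝ)) - (1 - s ^ 2 / 2)‖ ≤ s ^ 4 := by
    have := abs_exp_neg_sub_le (show 0 ≤ s ^ 2 / 2 by positivity)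
    rw [← Real.norm_eq_abs, ← Complex.norm_real] at this
    push_cast at this ⊢
    refine this.trans ?_
    nlinarith [sq_nonneg (s ^ 2)]
  have e : charFun (P.map V) s - Complex.exp (-(s ^ 2 / 2 : ℝ))
      = (charFun (P.map V) s - (1 - s ^ 2 / 2))
        - (Complex.exp (-(s ^ 2 / 2 : ℝ)) - (1 - s ^ 2 / 2)) := by ring
  rw [e]
  exact (norm_sub_le _ _).trans (add_le_add h1 h2)

/-- Telescoping: factors are exchanged one at a time, and those left alone have norm at most one. -/
lemma norm_prod_sub_prod_le {ι : Type*} (s : Finset ι) (a b : ι → ℂ) (ha : ∀ i, ‖a i‖ ≤ 1)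
    (hb : ∀ i, ‖b i‖ ≤ 1) :
    ‖∏ i ∈ s, a i - ∏ i ∈ s, b i‖ ≤ ∑ i ∈ s, ‖a i - b i‖ := by
  classical
  induction s using Finset.induction_on with
  | empty => simp
  | insert i s hi ih =>
    rw [Finset.prod_insert hi, Finset.prod_insert hi, Finset.sum_insert hi]
    have e : a i * ∏ j ∈ s, a j - b i * ∏ j ∈ s, b j
        = (a i - b i) * ∏ j ∈ s, a j + b i * (∏ j ∈ s, a j - ∏ j ∈ s, b j) := by ring
    rw [e]
    refine (norm_add_le _ _).trans (add_le_add ?_ ?_)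
    · rw [norm_mul, norm_prod]
      exact mul_le_of_le_one_right (norm_nonneg _)
        (Finset.prod_le_one (fun _ _ => norm_nonneg _) fun j _ => ha j)
    · rw [norm_mul]
      exact (mul_le_of_le_one_left (norm_nonneg _) (hb i)).trans ih

/-- The standing assumptions on a finite family of bootstrap weights. -/
structure IsWeightFamily {ι : Type*} (V : ι → Ω → ℝ) (P : Measure Ω) (C : ℝ) : Prop where
  measurable : ∀ i, Measurable (V i)
  indep : iIndepFun V P
  mean : ∀ i, ∫ ω, V i ω ∂P = 0
  var : ∀ i, Var[V i; P] = 1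
  memLp : ∀ i, MemLp (V i) 4 P
  four : ∀ i, ∫ ω, V i ω ^ 4 ∂P ≤ C

/-- Independence factors the characteristic function, and the Gaussian one splits in the same way,
so the factorwise errors add up. Cauchy–Schwarz on `|c_i| · c_i²` removes the third powers, leaving
only `∑ c_i²` and `∑ c_i⁴` to control. -/
lemma norm_charFun_weightedSum_sub_le {ι : Type*} [Fintype ι] {V : ι → Ω → ℝ} {C : ℝ}
    (hV : IsWeightFamily V P C) (hC : 0 ≤ C) (c : ι → ℝ) (t : ℝ) :
    ‖charFun (P.map fun ω => ∑ i, c i * V i ω) t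
        - Complex.exp (-(t ^ 2 * ∑ i, c i ^ 2) / 2 : ℝ)‖
      ≤ 4 * (1 + C) * |t| ^ 3 * √((∑ i, c i ^ 2) * ∑ i, c i ^ 4) + t ^ 4 * ∑ i, c i ^ 4 := by
  have hm : ∀ i, Measurable fun ω => c i * V i ω := fun i => (hV.measurable i).const_mul _
  have hi : iIndepFun (fun i ω => c i * V i ω) P :=
    hV.indep.comp (fun i x => c i * x) fun i => by fun_prop
  have h1 : charFun (P.map fun ω => ∑ i, c i * V i ω) t
      = ∏ i, charFun (P.map (V i)) (t * c i) := by
    rw [hi.charFun_map_fun_sum_eq_prod fun i => (hm i).aemeasurable]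
    simp only [Finset.prod_apply]
    refine Finset.prod_congr rfl fun i _ => ?_
    rw [charFun_map_mul_comp (hV.measurable i).aemeasurable, mul_comm]
  have h2 : Complex.exp (-(t ^ 2 * ∑ i, c i ^ 2) / 2 : ℝ)
      = ∏ i, Complex.exp (-((t * c i) ^ 2 / 2 : ℝ)) := by
    rw [← Complex.exp_sum]
    congr 1
    push_cast
    rw [Finset.sum_neg_distrib, Finset.mul_sum, neg_div, Finset.sum_div]
    simp [mul_pow]
  have hprob : ∀ i, IsProbabilityMeasure (P.map (V i)) := fun i =>
    Measure.isProbabilityMeasure_map (hV.measurable i).aemeasurable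
  rw [h1, h2]
  refine (norm_prod_sub_prod_le _ _ _ (fun i => norm_charFun_le_one _) fun i => ?_).trans ?_
  · rw [← Complex.ofReal_neg, Complex.norm_exp_ofReal]
    exact Real.exp_le_one_iff.2 (by simp; positivity)
  · refine (Finset.sum_le_sum fun i _ => norm_charFun_sub_gaussian_le (hV.measurable i) (hV.memLp i)
      (hV.mean i) (hV.var i) (hV.four i) (t * c i)).trans ?_
    have e : ∀ i, 4 * (1 + C) * |t * c i| ^ 3 + (t * c i) ^ 4
        = 4 * (1 + C) * |t| ^ 3 * |c i| ^ 3 + t ^ 4 * c i ^ 4 := fun i => by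
      rw [abs_mul]; ring
    simp only [e]
    rw [Finset.sum_add_distrib, ← Finset.mul_sum, ← Finset.mul_sum]
    have cs : ∑ i, |c i| ^ 3 ≤ √((∑ i, c i ^ 2) * ∑ i, c i ^ 4) := by
      refine Real.le_sqrt_of_sq_le ?_
      have := Finset.sum_mul_sq_le_sq_mul_sq Finset.univ (fun i => |c i|) (fun i => |c i| ^ 2)
      have e1 : ∀ i, |c i| * |c i| ^ 2 = |c i| ^ 3 := fun i => by ring
      have e2 : ∀ i, (|c i| ^ 2) ^ 2 = c i ^ 4 := fun i => by rw [sq_abs]; ring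
      rw [Finset.sum_congr rfl fun i _ => e1 i, Finset.sum_congr rfl fun i _ => e2 i,
        Finset.sum_congr rfl fun i _ => sq_abs (c i)] at this
      exact this
    gcongr

/-- Lyapunov-type central limit theorem along a triangular array of weighted sums. -/
lemma tendsto_weightedSum {ι : ℕ → Type*} [∀ n, Fintype (ι n)] {V : ∀ n, ι n → Ω → ℝ} {C : ℝ}
    (hC : 0 ≤ C) (hV : ∀ n, IsWeightFamily (V n) P C) (c : ∀ n, ι n → ℝ) (σ2 : ℝ≥0)
    (h2 : Tendsto (fun n => ∑ i, c n i ^ 2) atTop (𝓝 σ2))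
    (h4 : Tendsto (fun n => ∑ i, c n i ^ 4) atTop (𝓝 0))
    (μ : ℕ → ProbabilityMeasure ℝ)
    (hμ : ∀ n, (μ n : Measure ℝ) = P.map fun ω => ∑ i, c n i * V n i ω)
    (ν : ProbabilityMeasure ℝ) (hν : (ν : Measure ℝ) = gaussianReal 0 σ2) :
    Tendsto μ atTop (𝓝 ν) := by
  refine ProbabilityMeasure.tendsto_of_tendsto_charFun fun t => ?_
  rw [hν, charFun_gaussianReal]
  have hexp : Tendsto (fun n => Complex.exp (-(t ^ 2 * ∑ i, c n i ^ 2) / 2 : ℝ)) atTop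
      (𝓝 (Complex.exp (-(t ^ 2 * σ2) / 2 : ℝ))) := by
    refine (Complex.continuous_exp.comp Complex.continuous_ofReal).continuousAt.tendsto.comp ?_
    exact ((h2.const_mul _).neg).div_const _
  have hdiff : Tendsto (fun n => charFun (μ n : Measure ℝ) t
      - Complex.exp (-(t ^ 2 * ∑ i, c n i ^ 2) / 2 : ℝ)) atTop (𝓝 0) := by
    refine squeeze_zero_norm (fun n => ?_)
      (a := fun n => 4 * (1 + C) * |t| ^ 3 * √((∑ i, c n i ^ 2) * ∑ i, c n i ^ 4)
        + t ^ 4 * ∑ i, c n i ^ 4) ?_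
    · rw [hμ n]
      exact norm_charFun_weightedSum_sub_le (hV n) hC _ _
    · have := (((h2.mul h4).sqrt).const_mul (4 * (1 + C) * |t| ^ 3)).add (h4.const_mul (t ^ 4))
      simpa using this
  have := hdiff.add hexp
  simp only [sub_add_cancel, zero_add] at this
  convert this using 2
  push_cast
  ring_nf

/-- Non-asymptotic form: the distance of the law of a weighted sum from the Gaussian law is small,
uniformly in the array, once the coefficients are nearly normalized and negligible. -/
lemma exists_weightedSum_approx {ι : ℕ → Type*} [∀ n, Fintype (ι n)] {V : ∀ n, ι n → Ω → ℝ} {C : ℝ}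
    (hC : 0 ≤ C) (hV : ∀ n, IsWeightFamily (V n) P C) {σ2 : ℝ≥0} (hσ : σ2 ≠ 0) {ε : ℝ}
    (hε : 0 < ε) :
    ∃ δ > 0, ∀ n, ∀ c : ι n → ℝ, |∑ i, c i ^ 2 - σ2| < δ → ∑ i, c i ^ 4 < δ → ∀ x : ℝ,
      |(P.map fun ω => ∑ i, c i * V n i ω).real (Set.Iio x) - (gaussianReal 0 σ2).real (Set.Iio x)|
        < ε := by
  -- Failure for every `δ = 1/(k+1)` gives rows `n k` and coefficients `c k` forming a new
  -- triangular array indexed by `k`. The limit theorem applies to it whether or not `n k` tends to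
  -- infinity.
  by_contra! hcon
  choose n c h2 h4 x hx using fun k : ℕ => hcon (1 / ((k : ℝ) + 1)) (by positivity)
  have hlim := tendsto_one_div_add_atTop_nhds_zero_nat (𝕜 := ℝ)
  have hm : ∀ k, Measurable fun ω => ∑ i, c k i * V (n k) i ω := fun k =>
    Finset.measurable_sum _ fun i _ => ((hV (n k)).measurable i).const_mul _
  have hconv := tendsto_weightedSum hC (fun k => hV (n k)) c σ2
    (tendsto_iff_dist_tendsto_zero.2 (squeeze_zero (fun _ => dist_nonneg)
      (fun k => by rw [Real.dist_eq]; exact (h2 k).le) hlim))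
    (squeeze_zero (fun k => Finset.sum_nonneg fun i _ => by positivity)
      (fun k => (h4 k).le) hlim)
    (fun k => ⟨_, Measure.isProbabilityMeasure_map (hm k).aemeasurable⟩) (fun _ => rfl)
    ⟨gaussianReal 0 σ2, inferInstance⟩ rfl
  have hu := tendstoUniformly_measureReal_Iio (ν := ⟨gaussianReal 0 σ2, inferInstance⟩)
    (nullSingletonClass_gaussianReal hσ) hconv
  obtain ⟨k, hk⟩ := (Metric.tendstoUniformly_iff.1 hu ε hε).exists
  have := hk (x k)
  rw [dist_comm, Real.dist_eq] at this
  exact absurd (hx k) (not_le.2 this)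

end CLT

/-! ### Conditional law of a function of the data and independent weights -/

/-- If `V` is independent of `X`, the conditional law of `Φ(X, V)` given `X = x` is the law of
`Φ(x, V)`. -/
lemma condDistrib_ae_eq_map_of_indepFun {Ω α β : Type*} [MeasurableSpace Ω] [MeasurableSpace α]
    [MeasurableSpace β] {P : Measure Ω} [IsProbabilityMeasure P] {X : Ω → α} {V : Ω → β}
    (hX : Measurable X) (hV : Measurable V) (hXV : IndepFun X V P) {Φ : α → β → ℝ}
    (hΦ : Measurable (Function.uncurry Φ)) :
    ∀ᵐ ω ∂P, condDistrib (fun ω' => Φ (X ω') (V ω')) X P (X ω)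
      = P.map fun ω' => Φ (X ω) (V ω') := by
  have hVp : IsProbabilityMeasure (P.map V) := Measure.isProbabilityMeasure_map hV.aemeasurable
  have hXp : IsProbabilityMeasure (P.map X) := Measure.isProbabilityMeasure_map hX.aemeasurable
  -- The candidate kernel `x ↦ law of Φ(x, V)`. Conditional distributions are almost everywhere
  -- unique, so it suffices that it disintegrates the joint law of `(X, Φ(X, V))`.
  let η : Kernel α ℝ := (Kernel.id ×ₖ Kernel.const α (P.map V)).map (Function.uncurry Φ)
  have hηx : ∀ x, η x = P.map fun ω' => Φ x (V ω') := fun x => by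
    change ((Kernel.id ×ₖ Kernel.const α (P.map V)).map (Function.uncurry Φ)) x = _
    rw [Kernel.map_apply _ hΦ, Kernel.prod_apply, Kernel.id_apply, Kernel.const_apply,
      Measure.dirac_prod, Measure.map_map hΦ (by fun_prop), Measure.map_map (by fun_prop) hV]
    rfl
  have hmk : IsMarkovKernel η := Kernel.IsMarkovKernel.map _ hΦ
  have hΦX : Measurable fun ω' => Φ (X ω') (V ω') := hΦ.comp (hX.prodMk hV)
  have hpair : Measurable fun p : α × β => (p.1, Φ p.1 p.2) := measurable_fst.prodMk hΦ
  have key : P.map (fun ω => (X ω, Φ (X ω) (V ω))) = P.map X ⊗ₘ η := by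
    have hprod := (indepFun_iff_map_prod_eq_prod_map_map hX.aemeasurable hV.aemeasurable).1 hXV
    have e : P.map (fun ω => (X ω, Φ (X ω) (V ω)))
        = ((P.map X).prod (P.map V)).map fun p => (p.1, Φ p.1 p.2) := by
      rw [← hprod, Measure.map_map hpair (hX.prodMk hV)]
      rfl
    rw [e]
    ext s hs
    rw [Measure.map_apply hpair hs,
      Measure.prod_apply (hpair hs), Measure.compProd_apply hs]
    refine lintegral_congr fun x => ?_
    have hΦx : Measurable fun ω' => Φ x (V ω') := hΦ.comp (measurable_const.prodMk hV)
    rw [hηx, Measure.map_apply hΦx (measurable_prodMk_left hs),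
      Measure.map_apply hV (measurable_prodMk_left (hpair hs))]
    rfl
  have := condDistrib_ae_eq_of_measure_eq_compProd_of_measurable hX hΦX key
  filter_upwards [ae_of_ae_map hX.aemeasurable this] with ω hω
  rw [hω, hηx]

/-! ### The bootstrap statistic as a weighted sum of the external weights -/

/-- The trigonometric basis functions at the frequency `ℓ + 1`, at time `t + 1`. -/
def trigBasis (T K : ℕ) (i : Fin 2 × Fin K) (t : Fin T) : ℝ :=
  if i.1 = 0 then Real.cos (2 * Real.pi * ((i.2 : ℝ) + 1) * (((t : ℕ) + 1 : ℕ) / T))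
  else Real.sin (2 * Real.pi * ((i.2 : ℝ) + 1) * (((t : ℕ) + 1 : ℕ) / T))

/-- The trigonometric transform of the demeaned series. -/
def trigTransform (T K : ℕ) (d : Fin T → ℝ) (i : Fin 2 × Fin K) : ℝ :=
  (∑ t, (d t - (∑ s, d s) / T) * trigBasis T K i t) / √(T : ℝ)

lemma sum_Icc_one_eq_sum_fin {M : Type*} [AddCommMonoid M] (T : ℕ) (f : ℕ → M) :
    ∑ t ∈ Finset.Icc 1 T, f t = ∑ t : Fin T, f ((t : ℕ) + 1) := by
  rw [Fin.sum_univ_eq_sum_range (fun t => f (t + 1)), Finset.range_eq_Ico,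
    Finset.sum_Ico_add' f 0 T 1]
  rfl

/-- The pooled mean is common to all bootstrap observations and cancels. Exchanging the sums over
time and over basis functions then exposes the weights. -/
lemma bootstrapStat_eq_sum (T : Fin 2 → ℕ) (y : Fin 2 → ℕ → ℝ) (j : Fin 2) (K : ℕ)
    (hT : 0 < T j) (v : Fin 2 × Fin K → ℝ) :
    bootstrapStat T y j K v
      = ∑ i, trigTransform (T j) K (fun t => y j ((t : ℕ) + 1)) i / √(K : ℝ) * v i := by
  have hT' : (0 : ℝ) < T j := by exact_mod_cast hT
  have hs : √(T j : ℝ) * √(T j : ℝ) = T j := Real.mul_self_sqrt hT'.le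
  have hs0 : 0 < √(T j : ℝ) := Real.sqrt_pos.2 hT'
  have h1 : bootstrapStat T y j K v
      = (∑ t : Fin (T j), (y j ((t : ℕ) + 1) - (∑ s : Fin (T j), y j ((s : ℕ) + 1)) / T j)
          * externalVar (T j) K v ((t : ℕ) + 1)) / √(T j : ℝ) := by
    simp only [bootstrapStat, sampleMean, bootstrapObs, sum_Icc_one_eq_sum_fin]
    rw [Finset.sum_add_distrib]
    simp only [Finset.sum_const, Finset.card_univ, Fintype.card_fin, nsmul_eq_mul]
    have e : ∀ p A : ℝ, √(T j : ℝ) * ((T j * p + A) / T j - p) = A / √(T j : ℝ) := fun p A => by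
      have e' : (T j * p + A) / T j - p = A / T j := by field_simp; ring
      rw [e', ← mul_div_assoc, div_eq_div_iff hT'.ne' hs0.ne']
      linear_combination A * hs
    exact e _ _
  have h2 : ∀ t : Fin (T j), externalVar (T j) K v ((t : ℕ) + 1)
      = ∑ i, trigBasis (T j) K i t / √(K : ℝ) * v i := fun t => by
    rw [Fintype.sum_prod_type, Fin.sum_univ_two, ← Finset.sum_add_distrib, externalVar,
      Finset.mul_sum]
    refine Finset.sum_congr rfl fun l _ => ?_
    simp only [trigBasis, if_true, Fin.isValue, one_ne_zero, if_false]
    ring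
  rw [h1]
  simp only [h2, Finset.mul_sum, trigTransform, Finset.sum_div, Finset.sum_mul]
  rw [Finset.sum_comm]
  refine Finset.sum_congr rfl fun i _ => Finset.sum_congr rfl fun t _ => ?_
  ring

lemma measurable_trigTransform (T K : ℕ) (i : Fin 2 × Fin K) :
    Measurable fun d : Fin T → ℝ => trigTransform T K d i := by
  unfold trigTransform; fun_prop

/-! ### The limit law of the sample mean -/

/-- Evaluation at an interior time is not `J₁`-continuous, but every increasing bijection of `[0,1]`
fixes the endpoint `1`. -/
lemma isSkorokhodTestFunction_eval_one (f : BoundedContinuousFunction ℝ ℝ) (j : Fin 2) :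
    IsSkorokhodTestFunction fun x => f (x 1 j) where
  bounded := ⟨‖f‖, fun x => f.norm_coe_le_norm _⟩
  continuous := by
    rintro x x₀ - - ⟨τ, -, hx⟩
    refine (f.continuous.tendsto _).comp (((continuous_apply j).tendsto _).comp ?_)
    have h1 : ∀ n, τ n 1 = 1 := fun n => (τ n).map_top
    simpa only [h1] using hx.tendsto_at 1

lemma sqrt_mul_sampleMean_sub {Ω : Type*} {u : ℤ → Ω → ℝ} {y : ℕ → Ω → ℝ} {m : ℝ}
    (hY : ∀ t ω, y t ω = m + u (t : ℤ) ω) {T : ℕ} (ω : Ω) :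
    √(T : ℝ) * (sampleMean T (fun t => y t ω) - m)
      = (∑ t ∈ Finset.Icc 1 T, u (t : ℤ) ω) / √(T : ℝ) := by
  rcases Nat.eq_zero_or_pos T with rfl | hT
  · simp
  have hT' : (0 : ℝ) < T := by exact_mod_cast hT
  have hs : √(T : ℝ) * √(T : ℝ) = T := Real.mul_self_sqrt hT'.le
  have hs0 : 0 < √(T : ℝ) := Real.sqrt_pos.2 hT'
  simp only [sampleMean, hY, Finset.sum_add_distrib, Finset.sum_const, Nat.card_Icc,
    Nat.add_sub_cancel, nsmul_eq_mul]
  field_simp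
  rw [pow_two, hs]
  ring

lemma tendstoUniformly_sampleMean {Ω Ω' : Type*} [MeasurableSpace Ω] [MeasurableSpace Ω']
    {P : Measure Ω} [IsProbabilityMeasure P] {P' : Measure Ω'} [IsProbabilityMeasure P']
    {u : Fin 2 → ℤ → Ω → ℝ} (hu_meas : ∀ j t, Measurable (u j t)) {LRV : Fin 2 → ℝ}
    {W : Fin 2 → ℝ≥0 → Ω' → ℝ} (hW : IsStandardBrownian₂ W P')
    (hFCLT : FunctionalCLT u P LRV W P') (j : Fin 2) (hpos : 0 < LRV j) :
    TendstoUniformly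
      (fun (T : ℕ) x => (P.map fun ω => (∑ t ∈ Finset.Icc 1 T, u j (t : ℤ) ω) / √(T : ℝ)).real
        (Set.Iio x))
      (fun x => (gaussianReal 0 (LRV j).toNNReal).real (Set.Iio x)) atTop := by
  have hm : ∀ T : ℕ, Measurable fun ω => (∑ t ∈ Finset.Icc 1 T, u j (t : ℤ) ω) / √(T : ℝ) :=
    fun T => by have := hu_meas j; fun_prop
  have hlaw : HasLaw (fun ω' => √(LRV j) * W j 1 ω') (gaussianReal 0 (LRV j).toNNReal) P' := by
    have h := gaussianReal_const_mul ((hW.isBrownian j).hasLaw_eval 1) √(LRV j)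
    convert h using 2
    · simp
    · ext; simp [Real.sq_sqrt hpos.le, hpos.le]
  have hσ : (LRV j).toNNReal ≠ 0 := (Real.toNNReal_pos.2 hpos).ne'
  refine tendstoUniformly_measureReal_Iio
    (μ := fun T => ⟨P.map fun ω => (∑ t ∈ Finset.Icc 1 T, u j (t : ℤ) ω) / √(T : ℝ),
      Measure.isProbabilityMeasure_map (hm T).aemeasurable⟩)
    (ν := ⟨gaussianReal 0 (LRV j).toNNReal, inferInstance⟩)
    (nullSingletonClass_gaussianReal hσ)
    (ProbabilityMeasure.tendsto_iff_forall_integral_tendsto.2 fun f => ?_)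
  have h := hFCLT _ (isSkorokhodTestFunction_eval_one f j)
  have e1 : ∫ ω', f (scaledBrownianPath LRV W ω' 1 j) ∂P'
      = ∫ x, f x ∂(gaussianReal 0 (LRV j).toNNReal) := by
    rw [← hlaw.map_eq, integral_map hlaw.aemeasurable (by fun_prop)]
    simp only [scaledBrownianPath]
    congr! with ω'
  have e2 : ∀ T : ℕ, ∫ ω, f (partialSumProcess u T ω 1 j) ∂P
      = ∫ x, f x ∂(P.map fun ω => (∑ t ∈ Finset.Icc 1 T, u j (t : ℤ) ω) / √(T : ℝ)) :=
    fun T => by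
      rw [integral_map (hm T).aemeasurable (by fun_prop)]
      simp [partialSumProcess]
  simp only [e1, e2] at h
  exact h

/-! ### Second and fourth moments of linear forms in a weakly dependent process -/

section Moments

variable {Ω : Type*} [MeasurableSpace Ω] {P : Measure Ω} {X : ℤ → Ω → ℝ}

lemma IsFourthOrderStationary.integral_mul (hX : IsFourthOrderStationary X P) (s t : ℤ) :
    ∫ ω, X s ω * X t ω ∂P = autocov X P (t - s) := by
  have := hX.shift 2 (by norm_num) ![0, t - s] s
  simpa [Fin.prod_univ_two, autocov] using this

lemma IsFourthOrderStationary.integral_mul₄ (hX : IsFourthOrderStationary X P) (a b c d : ℤ) :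
    ∫ ω, X a ω * X b ω * X c ω * X d ω ∂P
      = ∫ ω, X 0 ω * X (b - a) ω * X (c - a) ω * X (d - a) ω ∂P := by
  have := hX.shift 4 le_rfl ![0, b - a, c - a, d - a] a
  simpa [Fin.prod_univ_four] using this

/-- The fourth-order cumulant in terms of moments. -/
lemma WeakDependence.integral_mul₄ (hX : WeakDependence X P) (a b c d : ℤ) :
    ∫ ω, X a ω * X b ω * X c ω * X d ω ∂P
      = autocov X P (b - a) * autocov X P (d - c) + autocov X P (c - a) * autocov X P (d - b)
        + autocov X P (d - a) * autocov X P (c - b)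
        + cumulant₄ (X 0) (X (b - a)) (X (c - a)) (X (d - a)) P := by
  rw [hX.stationary.integral_mul₄]
  simp only [cumulant₄, covariance, hX.mean_zero, sub_zero, hX.stationary.integral_mul]
  simp only [sub_sub_sub_cancel_right]
  ring

lemma WeakDependence.summable_abs_autocov (hX : WeakDependence X P) :
    Summable fun h : ℤ => |autocov X P h| := by
  -- The weight `|h|³` vanishes at lag zero, so that one term has to be added back.
  have h0 : Summable fun h : ℤ => if h = 0 then |autocov X P 0| else 0 :=
    (hasSum_ite_eq (0 : ℤ) |autocov X P 0|).summable
  refine Summable.of_nonneg_of_le (fun _ => abs_nonneg _) (fun h => ?_)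
    (hX.summable_autocov.add h0)
  rcases eq_or_ne h 0 with rfl | hh
  · simp
  · have h1 : (1 : ℝ) ≤ |(h : ℝ)| := by exact_mod_cast Int.one_le_abs hh
    have h2 : (1 : ℝ) ≤ |(h : ℝ)| ^ 3 := one_le_pow₀ h1
    simpa [hh] using le_mul_of_one_le_left (abs_nonneg _) h2

lemma WeakDependence.summable_abs_mul_autocov (hX : WeakDependence X P) :
    Summable fun h : ℤ => |(h : ℝ)| * |autocov X P h| := by
  refine Summable.of_nonneg_of_le (fun _ => by positivity) (fun h => ?_) hX.summable_autocov
  refine mul_le_mul_of_nonneg_right ?_ (abs_nonneg _)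
  rcases eq_or_ne h 0 with rfl | hh
  · simp
  · have h1 : (1 : ℝ) ≤ |(h : ℝ)| := by exact_mod_cast Int.one_le_abs hh
    exact le_self_pow₀ h1 (by norm_num)

lemma sum_comp_le_tsum {ι β : Type*} [Fintype ι] {g : β → ℝ} (hg : Summable g)
    (h0 : ∀ b, 0 ≤ g b) {e : ι → β} (he : Function.Injective e) :
    ∑ i, g (e i) ≤ ∑' b, g b := by
  rw [← tsum_fintype (L := .unconditional ι)]
  exact tsum_comp_le_tsum_of_inj hg h0 he

lemma sum_sum_sub_le {ι : Type*} [Fintype ι] {τ : ι → ℤ} (hτ : Function.Injective τ) {g : ℤ → ℝ}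
    (hg : Summable g) (h0 : ∀ b, 0 ≤ g b) :
    ∑ s, ∑ t, g (τ t - τ s) ≤ Fintype.card ι * ∑' h, g h := by
  have : ∀ s, ∑ t, g (τ t - τ s) ≤ ∑' h, g h := fun s =>
    sum_comp_le_tsum hg h0 fun t t' h => hτ (sub_left_injective h)
  refine (Finset.sum_le_sum fun s _ => this s).trans ?_
  simp

/-- The sum of all absolute autocovariances. -/
def absAutocovSum (X : ℤ → Ω → ℝ) (P : Measure Ω) : ℝ := ∑' h : ℤ, |autocov X P h|

/-- The sum of all absolute fourth-order cumulants. -/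
def absCumulantSum (X : ℤ → Ω → ℝ) (P : Measure Ω) : ℝ :=
  ∑' h : ℤ × ℤ × ℤ, |cumulant₄ (X 0) (X h.1) (X h.2.1) (X h.2.2) P|

lemma absCumulantSum_nonneg : 0 ≤ absCumulantSum X P := tsum_nonneg fun _ => abs_nonneg _

lemma absAutocovSum_nonneg : 0 ≤ absAutocovSum X P := tsum_nonneg fun _ => abs_nonneg _

/-! ### Moments of linear forms with general coefficients -/

section LinearForms

variable {ι : Type*} [Fintype ι] (τ : ι → ℤ)

/-- The linear form `∑ a_t X_{τ(t)}`. -/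
def linForm (X : ℤ → Ω → ℝ) (a : ι → ℝ) (ω : Ω) : ℝ := ∑ t, a t * X (τ t) ω

/-- The covariance of two linear forms. -/
def covForm (X : ℤ → Ω → ℝ) (P : Measure Ω) (a b : ι → ℝ) : ℝ :=
  ∑ s, ∑ t, a s * b t * autocov X P (τ t - τ s)

lemma WeakDependence.integrable_mul₄ (hX : WeakDependence X P) (a b c d : ℤ) :
    Integrable (fun ω => X a ω * X b ω * X c ω * X d ω) P := by
  have hm := fun t => (hX.stationary.memLp t).aestronglyMeasurable
  have h4 := fun t => integrable_pow_four (hX.stationary.memLp t)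
  refine Integrable.mono' ((((h4 a).add (h4 b)).add (h4 c)).add (h4 d))
    ((((hm a).mul (hm b)).mul (hm c)).mul (hm d)) (Eventually.of_forall fun ω => ?_)
  simp only [Pi.add_apply, Real.norm_eq_abs]
  generalize X a ω = x
  generalize X b ω = y
  generalize X c ω = z
  generalize X d ω = w
  rw [abs_le]
  constructor <;> nlinarith [sq_nonneg (x * y + z * w), sq_nonneg (x * y - z * w),
    sq_nonneg (x ^ 2 - y ^ 2), sq_nonneg (z ^ 2 - w ^ 2), sq_nonneg (x ^ 2), sq_nonneg (y ^ 2),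
    sq_nonneg (z ^ 2), sq_nonneg (w ^ 2)]

lemma WeakDependence.integrable_mul [IsFiniteMeasure P] (hX : WeakDependence X P) (a b : ℤ) :
    Integrable (fun ω => X a ω * X b ω) P :=
  MemLp.integrable_mul ((hX.stationary.memLp a).mono_exponent (by norm_num) : MemLp (X a) 2 P)
    ((hX.stationary.memLp b).mono_exponent (by norm_num) : MemLp (X b) 2 P)

lemma WeakDependence.integral_linForm_mul [IsFiniteMeasure P] (hX : WeakDependence X P)
    (a b : ι → ℝ) :
    ∫ ω, linForm τ X a ω * linForm τ X b ω ∂P = covForm τ X P a b := by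
  have e : ∀ ω, linForm τ X a ω * linForm τ X b ω
      = ∑ s, ∑ t, a s * b t * (X (τ s) ω * X (τ t) ω) := fun ω => by
    simp only [linForm]
    rw [Finset.sum_mul_sum]
    exact Finset.sum_congr rfl fun s _ => Finset.sum_congr rfl fun t _ => by ring
  have hi : ∀ s t, Integrable (fun ω => a s * b t * (X (τ s) ω * X (τ t) ω)) P := fun s t =>
    (hX.integrable_mul _ _).const_mul _
  simp only [e]
  rw [integral_finsetSum _ fun s _ => integrable_finsetSum _ fun t _ => hi s t]
  refine Finset.sum_congr rfl fun s _ => ?_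
  rw [integral_finsetSum _ fun t _ => hi s t]
  refine Finset.sum_congr rfl fun t _ => ?_
  rw [integral_const_mul, hX.stationary.integral_mul]

/-- This and its two variants index a product of double sums by the three pairings of `{s, s', t,
t'}`, matching the three Gaussian terms of a fourth moment. -/
lemma sum_mul_sum_four (f g : ι → ι → ℝ) :
    (∑ s, ∑ s', f s s') * (∑ t, ∑ t', g t t') = ∑ s, ∑ s', ∑ t, ∑ t', f s s' * g t t' := by
  rw [Finset.sum_mul]
  refine Finset.sum_congr rfl fun s _ => ?_
  rw [Finset.sum_mul]
  refine Finset.sum_congr rfl fun s' _ => ?_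
  rw [Finset.mul_sum]
  exact Finset.sum_congr rfl fun t _ => Finset.mul_sum _ _ _

lemma sum_mul_sum_four_swap (f g : ι → ι → ℝ) :
    (∑ s, ∑ s', f s s') * (∑ t, ∑ t', g t t') = ∑ s, ∑ s', ∑ t, ∑ t', f s t * g s' t' := by
  rw [sum_mul_sum_four]
  exact Finset.sum_congr rfl fun s _ => Finset.sum_comm

lemma sum_mul_sum_four_cross (f g : ι → ι → ℝ) :
    (∑ s, ∑ s', f s s') * (∑ t, ∑ t', g t t') = ∑ s, ∑ s', ∑ t, ∑ t', f s t' * g s' t := by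
  rw [sum_mul_sum_four_swap]
  exact Finset.sum_congr rfl fun s _ => Finset.sum_congr rfl fun s' _ => Finset.sum_comm

lemma linForm_sq_mul_sq {Ω : Type*} (X : ℤ → Ω → ℝ) (a b : ι → ℝ) (ω : Ω) :
    linForm τ X a ω ^ 2 * linForm τ X b ω ^ 2 = ∑ s, ∑ s', ∑ t, ∑ t', a s * a s' * b t * b t'
      * (X (τ s) ω * X (τ s') ω * X (τ t) ω * X (τ t') ω) := by
  simp only [linForm]
  rw [pow_two, pow_two, Finset.sum_mul_sum, Finset.sum_mul_sum, sum_mul_sum_four]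
  refine Finset.sum_congr rfl fun s _ => Finset.sum_congr rfl fun s' _ =>
    Finset.sum_congr rfl fun t _ => Finset.sum_congr rfl fun t' _ => by ring

lemma WeakDependence.integrable_linForm_sq_mul_sq (hX : WeakDependence X P) (a b : ι → ℝ) :
    Integrable (fun ω => linForm τ X a ω ^ 2 * linForm τ X b ω ^ 2) P := by
  simp only [linForm_sq_mul_sq]
  exact integrable_finsetSum _ fun s _ => integrable_finsetSum _ fun s' _ =>
    integrable_finsetSum _ fun t _ => integrable_finsetSum _ fun t' _ =>
      (hX.integrable_mul₄ _ _ _ _).const_mul _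

lemma WeakDependence.integrable_linForm_sq [IsFiniteMeasure P] (hX : WeakDependence X P)
    (a : ι → ℝ) : Integrable (fun ω => linForm τ X a ω ^ 2) P := by
  have e : ∀ ω, linForm τ X a ω ^ 2 = ∑ s, ∑ t, a s * a t * (X (τ s) ω * X (τ t) ω) := fun ω => by
    simp only [linForm, pow_two]
    rw [Finset.sum_mul_sum]
    exact Finset.sum_congr rfl fun s _ => Finset.sum_congr rfl fun t _ => by ring
  simp only [e]
  exact integrable_finsetSum _ fun s _ => integrable_finsetSum _ fun t _ =>
    (hX.integrable_mul _ _).const_mul _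

/-- With `s` fixed, the triple of lags determines `(s', t, t')`, so the inner sums are bounded by
the full cumulant sum. Only the free index `s` costs a factor. -/
lemma sum_abs_cumulant_le (hX : WeakDependence X P) (hτ : Function.Injective τ) :
    ∑ s, ∑ s', ∑ t, ∑ t', |cumulant₄ (X 0) (X (τ s' - τ s)) (X (τ t - τ s)) (X (τ t' - τ s)) P|
      ≤ Fintype.card ι * absCumulantSum X P := by
  have : ∀ s, ∑ s', ∑ t, ∑ t',
      |cumulant₄ (X 0) (X (τ s' - τ s)) (X (τ t - τ s)) (X (τ t' - τ s)) P|
        ≤ absCumulantSum X P := fun s => by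
    have h := sum_comp_le_tsum hX.summable_cumulant (fun _ => abs_nonneg _)
      (e := fun p : ι × ι × ι => (τ p.1 - τ s, τ p.2.1 - τ s, τ p.2.2 - τ s)) (by
        rintro ⟨p, q, r⟩ ⟨p', q', r'⟩ h
        simp only [Prod.mk.injEq, sub_left_inj] at h
        simp [hτ h.1, hτ h.2.1, hτ h.2.2])
    simp only [Fintype.sum_prod_type] at h
    exact h
  refine (Finset.sum_le_sum fun s _ => this s).trans ?_
  simp

/-- Fourth moments of linear forms: the Gaussian part plus a cumulant remainder. -/
lemma WeakDependence.abs_integral_linForm_sq_mul_sq_sub_le (hX : WeakDependence X P)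
    (hτ : Function.Injective τ) {M : ℝ} {a b : ι → ℝ} (ha : ∀ t, |a t| ≤ M)
    (hb : ∀ t, |b t| ≤ M) :
    |∫ ω, linForm τ X a ω ^ 2 * linForm τ X b ω ^ 2 ∂P
        - (covForm τ X P a a * covForm τ X P b b + 2 * covForm τ X P a b ^ 2)|
      ≤ M ^ 4 * (Fintype.card ι * absCumulantSum X P) := by
  have hi : ∀ s s' t t', Integrable (fun ω => a s * a s' * b t * b t'
      * (X (τ s) ω * X (τ s') ω * X (τ t) ω * X (τ t') ω)) P := fun s s' t t' =>
    (hX.integrable_mul₄ _ _ _ _).const_mul _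
  have e : ∫ ω, linForm τ X a ω ^ 2 * linForm τ X b ω ^ 2 ∂P
      = ∑ s, ∑ s', ∑ t, ∑ t', a s * a s' * b t * b t'
        * ∫ ω, X (τ s) ω * X (τ s') ω * X (τ t) ω * X (τ t') ω ∂P := by
    simp only [linForm_sq_mul_sq]
    rw [integral_finsetSum _ fun s _ => integrable_finsetSum _ fun s' _ =>
      integrable_finsetSum _ fun t _ => integrable_finsetSum _ fun t' _ => hi s s' t t']
    refine Finset.sum_congr rfl fun s _ => ?_
    rw [integral_finsetSum _ fun s' _ =>
      integrable_finsetSum _ fun t _ => integrable_finsetSum _ fun t' _ => hi s s' t t']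
    refine Finset.sum_congr rfl fun s' _ => ?_
    rw [integral_finsetSum _ fun t _ => integrable_finsetSum _ fun t' _ => hi s s' t t']
    refine Finset.sum_congr rfl fun t _ => ?_
    rw [integral_finsetSum _ fun t' _ => hi s s' t t']
    exact Finset.sum_congr rfl fun t' _ => integral_const_mul _ _
  have e' : ∫ ω, linForm τ X a ω ^ 2 * linForm τ X b ω ^ 2 ∂P
        - (covForm τ X P a a * covForm τ X P b b + 2 * covForm τ X P a b ^ 2)
      = ∑ s, ∑ s', ∑ t, ∑ t', a s * a s' * b t * b t'
        * cumulant₄ (X 0) (X (τ s' - τ s)) (X (τ t - τ s)) (X (τ t' - τ s)) P := by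
    have h1 : covForm τ X P a a * covForm τ X P b b = _ := sum_mul_sum_four _ _
    have h2 : covForm τ X P a b * covForm τ X P a b = _ := sum_mul_sum_four_swap _ _
    have h3 : covForm τ X P a b * covForm τ X P a b = _ := sum_mul_sum_four_cross _ _
    have h4 : 2 * covForm τ X P a b ^ 2 = covForm τ X P a b * covForm τ X P a b
      + covForm τ X P a b * covForm τ X P a b := by ring
    -- The two copies of the squared cross-covariance are expanded along different pairings, so that
    -- the Gaussian terms cancel one by one.
    rw [e, h4, h1, sub_eq_iff_eq_add]
    nth_rewrite 1 [h2]
    rw [h3]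
    simp only [← Finset.sum_add_distrib]
    refine Finset.sum_congr rfl fun s _ => Finset.sum_congr rfl fun s' _ =>
      Finset.sum_congr rfl fun t _ => Finset.sum_congr rfl fun t' _ => ?_
    rw [hX.integral_mul₄]
    ring
  rw [e']
  refine le_trans ?_ (mul_le_mul_of_nonneg_left (sum_abs_cumulant_le τ hX hτ) (by positivity))
  simp only [Finset.mul_sum]
  refine (Finset.abs_sum_le_sum_abs _ _).trans (Finset.sum_le_sum fun s _ => ?_)
  refine (Finset.abs_sum_le_sum_abs _ _).trans (Finset.sum_le_sum fun s' _ => ?_)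
  refine (Finset.abs_sum_le_sum_abs _ _).trans (Finset.sum_le_sum fun t _ => ?_)
  refine (Finset.abs_sum_le_sum_abs _ _).trans (Finset.sum_le_sum fun t' _ => ?_)
  have hM : 0 ≤ M := (abs_nonneg _).trans (ha s)
  rw [abs_mul]
  refine mul_le_mul_of_nonneg_right ?_ (abs_nonneg _)
  rw [abs_mul, abs_mul, abs_mul]
  have : M ^ 4 = M * M * M * M := by ring
  rw [this]
  gcongr
  · exact ha s
  · exact ha s'
  · exact hb t
  · exact hb t'

lemma WeakDependence.abs_covForm_le (hX : WeakDependence X P) (hτ : Function.Injective τ) {M : ℝ}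
    {a b : ι → ℝ} (ha : ∀ t, |a t| ≤ M) (hb : ∀ t, |b t| ≤ M) :
    |covForm τ X P a b| ≤ M ^ 2 * (Fintype.card ι * absAutocovSum X P) := by
  refine le_trans ?_ (mul_le_mul_of_nonneg_left
    (sum_sum_sub_le hτ hX.summable_abs_autocov fun _ => abs_nonneg _) (by positivity))
  simp only [Finset.mul_sum]
  refine (Finset.abs_sum_le_sum_abs _ _).trans (Finset.sum_le_sum fun s _ => ?_)
  refine (Finset.abs_sum_le_sum_abs _ _).trans (Finset.sum_le_sum fun t _ => ?_)
  have hM : 0 ≤ M := (abs_nonneg _).trans (ha s)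
  rw [abs_mul, abs_mul, pow_two]
  gcongr
  · exact ha s
  · exact hb t

/-- The covariance operator is bounded by the sum of the absolute autocovariances. -/
lemma WeakDependence.sum_sq_autocov_apply_le (hX : WeakDependence X P)
    (hτ : Function.Injective τ) (b : ι → ℝ) :
    ∑ t, (∑ s, b s * autocov X P (τ t - τ s)) ^ 2 ≤ absAutocovSum X P ^ 2 * ∑ s, b s ^ 2 := by
  have hrow : ∀ t, ∑ s, |autocov X P (τ t - τ s)| ≤ absAutocovSum X P := fun t =>
    sum_comp_le_tsum hX.summable_abs_autocov (fun _ => abs_nonneg _)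
      (e := fun s => τ t - τ s) fun s s' h => hτ (sub_right_injective h)
  have hcol : ∀ s, ∑ t, |autocov X P (τ t - τ s)| ≤ absAutocovSum X P := fun s =>
    sum_comp_le_tsum hX.summable_abs_autocov (fun _ => abs_nonneg _)
      (e := fun t => τ t - τ s) fun t t' h => hτ (sub_left_injective h)
  have hG : 0 ≤ absAutocovSum X P := absAutocovSum_nonneg
  -- Schur test: Cauchy–Schwarz with weights `|γ(τ t - τ s)|`, followed by row and column sums
  -- bounded by the same constant.
  have h1 : ∀ t, (∑ s, b s * autocov X P (τ t - τ s)) ^ 2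
      ≤ absAutocovSum X P * ∑ s, |autocov X P (τ t - τ s)| * b s ^ 2 := fun t => by
    refine (Finset.sum_sq_le_sum_mul_sum_of_sq_le_mul Finset.univ
      (f := fun s => |autocov X P (τ t - τ s)|)
      (g := fun s => |autocov X P (τ t - τ s)| * b s ^ 2)
      (fun s _ => abs_nonneg _) (fun s _ => by positivity) (fun s _ => le_of_eq ?_)).trans
      (mul_le_mul_of_nonneg_right (hrow t) (Finset.sum_nonneg fun s _ => by positivity))
    rw [mul_pow, ← sq_abs (autocov X P _)]
    ring
  refine (Finset.sum_le_sum fun t _ => h1 t).trans ?_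
  rw [← Finset.mul_sum, Finset.sum_comm, pow_two, mul_assoc]
  refine mul_le_mul_of_nonneg_left ?_ hG
  rw [Finset.mul_sum]
  refine Finset.sum_le_sum fun s _ => ?_
  rw [← Finset.sum_mul]
  exact mul_le_mul_of_nonneg_right (hcol s) (sq_nonneg _)

/-- Bessel's inequality for an orthogonal family of vectors of squared norm `1/2`. -/
lemma sum_sq_le_of_orthogonal {I : Type*} [Fintype I] [DecidableEq I] {e : I → ι → ℝ}
    (he : ∀ i k, ∑ t, e i t * e k t = if i = k then 1 / 2 else 0) (w : ι → ℝ) :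
    ∑ i, (∑ t, e i t * w t) ^ 2 ≤ 1 / 2 * ∑ t, w t ^ 2 := by
  set β : I → ℝ := fun i => ∑ t, e i t * w t with hβ
  have h1 : ∑ t, (∑ i, β i * e i t) ^ 2 = 1 / 2 * ∑ i, β i ^ 2 := by
    have : ∀ t, (∑ i, β i * e i t) ^ 2 = ∑ i, ∑ k, β i * β k * (e i t * e k t) := fun t => by
      rw [pow_two, Finset.sum_mul_sum]
      exact Finset.sum_congr rfl fun i _ => Finset.sum_congr rfl fun k _ => by ring
    simp only [this]
    rw [Finset.sum_comm, Finset.mul_sum]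
    refine Finset.sum_congr rfl fun i _ => ?_
    rw [Finset.sum_comm]
    simp only [← Finset.mul_sum, he, mul_ite, mul_zero, Finset.sum_ite_eq, Finset.mem_univ,
      if_true]
    ring
  have h2 : ∑ t, w t * ∑ i, β i * e i t = ∑ i, β i ^ 2 := by
    simp only [Finset.mul_sum]
    rw [Finset.sum_comm]
    refine Finset.sum_congr rfl fun i _ => ?_
    rw [pow_two]
    nth_rewrite 3 [hβ]
    rw [Finset.mul_sum]
    exact Finset.sum_congr rfl fun t _ => by ring
  -- Since the vectors have squared norm `1/2`, the orthogonal projection of `w` onto their span is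
  -- `2 ∑ β_i e_i`.
  have h3 : 0 ≤ ∑ t, (w t - 2 * ∑ i, β i * e i t) ^ 2 :=
    Finset.sum_nonneg fun _ _ => sq_nonneg _
  have h4 : ∑ t, (w t - 2 * ∑ i, β i * e i t) ^ 2
      = ∑ t, w t ^ 2 - 4 * ∑ t, w t * ∑ i, β i * e i t + 4 * ∑ t, (∑ i, β i * e i t) ^ 2 := by
    rw [Finset.mul_sum, Finset.mul_sum, ← Finset.sum_sub_distrib, ← Finset.sum_add_distrib]
    exact Finset.sum_congr rfl fun t _ => by ring
  rw [h4, h1, h2] at h3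
  linarith

/-- For fixed `i` the covariances are the inner products of the `e k` with the covariance operator
applied to `e i`. Bessel gives one factor `1/2` and `‖e i‖² = 1/2` the other. Each row is thus
bounded independently of the number of forms, which is what makes the variance of the bootstrap
variance vanish. -/
lemma WeakDependence.sum_covForm_sq_le (hX : WeakDependence X P) (hτ : Function.Injective τ)
    {I : Type*} [Fintype I] [DecidableEq I] {e : I → ι → ℝ}
    (he : ∀ i k, ∑ t, e i t * e k t = if i = k then 1 / 2 else 0) :
    ∑ i, ∑ k, covForm τ X P (e i) (e k) ^ 2
      ≤ Fintype.card I * (absAutocovSum X P ^ 2 / 4) := by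
  have h : ∀ i, ∑ k, covForm τ X P (e i) (e k) ^ 2 ≤ absAutocovSum X P ^ 2 / 4 := fun i => by
    have h1 : ∀ k, covForm τ X P (e i) (e k)
        = ∑ t, e k t * ∑ s, e i s * autocov X P (τ t - τ s) := fun k => by
      simp only [covForm, Finset.mul_sum]
      rw [Finset.sum_comm]
      exact Finset.sum_congr rfl fun t _ => Finset.sum_congr rfl fun s _ => by ring
    simp only [h1]
    have h2 := sum_sq_le_of_orthogonal he fun t => ∑ s, e i s * autocov X P (τ t - τ s)
    have h3 := hX.sum_sq_autocov_apply_le τ hτ (e i)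
    have h4 := he i i
    simp only [if_true, ← pow_two] at h4
    rw [h4] at h3
    linarith
  refine (Finset.sum_le_sum fun i _ => h i).trans ?_
  simp

/-- The second moment of a sum of squared linear forms with orthogonal coefficients exceeds the
square of its mean by a term linear in the number of forms, up to cumulants. -/
lemma WeakDependence.integral_sum_linForm_sq_sq_le [IsFiniteMeasure P] (hX : WeakDependence X P)
    (hτ : Function.Injective τ) {I : Type*} [Fintype I] [DecidableEq I] {e : I → ι → ℝ} {M : ℝ}
    (hM : ∀ i t, |e i t| ≤ M)
    (he : ∀ i k, ∑ t, e i t * e k t = if i = k then 1 / 2 else 0) :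
    ∫ ω, (∑ i, linForm τ X (e i) ω ^ 2) ^ 2 ∂P
      ≤ (∑ i, covForm τ X P (e i) (e i)) ^ 2 + Fintype.card I * (absAutocovSum X P ^ 2 / 2)
        + (Fintype.card I : ℝ) ^ 2 * (M ^ 4 * (Fintype.card ι * absCumulantSum X P)) := by
  have hi := fun i k => hX.integrable_linForm_sq_mul_sq τ (e i) (e k)
  simp only [pow_two (∑ i, _), Finset.sum_mul_sum]
  rw [integral_finsetSum _ fun i _ => integrable_finsetSum _ fun k _ => hi i k]
  simp only [fun i => integral_finsetSum Finset.univ fun k _ => hi i k]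
  have hb := fun i k => (abs_le.1 (hX.abs_integral_linForm_sq_mul_sq_sub_le τ hτ (hM i) (hM k))).2
  refine (Finset.sum_le_sum fun i _ => Finset.sum_le_sum fun k _ =>
    sub_le_iff_le_add.1 (hb i k)).trans ?_
  simp only [Finset.sum_add_distrib, ← Finset.mul_sum]
  have hc := hX.sum_covForm_sq_le τ hτ he
  simp only [Finset.sum_const, Finset.card_univ, nsmul_eq_mul]
  linarith

end LinearForms

end Moments

/-! ### Orthogonality of the trigonometric basis -/

/-- A geometric sum whose ratio is a `T`-th root of unity. The ratio is not `1`, since `T` cannot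
divide `k` when `0 < |k| < T`. -/
lemma sum_exp_fourier_eq_zero {T : ℕ} {k : ℤ} (hk : k ≠ 0) (hkT : |k| < T) :
    ∑ t : Fin T, Complex.exp
      ((2 * Real.pi * (k : ℝ) * ((((t : ℕ) + 1 : ℕ) : ℝ) / T) : ℝ) * Complex.I) = 0 := by
  have hT : (T : ℂ) ≠ 0 := by
    have : (0 : ℤ) < T := (abs_nonneg k).trans_lt hkT
    exact_mod_cast this.ne'
  set z : ℂ := Complex.exp (2 * Real.pi * k / T * Complex.I) with hz
  have h1 : ∀ t : Fin T, Complex.exp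
      ((2 * Real.pi * (k : ℝ) * ((((t : ℕ) + 1 : ℕ) : ℝ) / T) : ℝ) * Complex.I)
        = z * z ^ (t : ℕ) := fun t => by
    rw [← pow_succ', hz, ← Complex.exp_nat_mul]
    congr 1
    push_cast
    ring
  have hzT : z ^ T = 1 := by
    rw [hz, ← Complex.exp_nat_mul]
    refine Complex.exp_eq_one_iff.2 ⟨k, ?_⟩
    field_simp
  have hz1 : z ≠ 1 := fun h => by
    obtain ⟨n, hn⟩ := Complex.exp_eq_one_iff.1 h
    have h2 : (k : ℂ) = n * T := by
      have hpi : (2 * Real.pi * Complex.I : ℂ) ≠ 0 := Complex.two_pi_I_ne_zero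
      have h3 : (2 * Real.pi * Complex.I : ℂ) * k = (2 * Real.pi * Complex.I) * (n * T) := by
        field_simp at hn
        linear_combination (2 * Real.pi * Complex.I : ℂ) * hn
      exact mul_left_cancel₀ hpi h3
    have h3 : k = n * T := by exact_mod_cast h2
    exact hk (Int.eq_zero_of_abs_lt_dvd ⟨n, by rw [h3]; ring⟩ hkT)
  simp only [h1]
  rw [← Finset.mul_sum, Fin.sum_univ_eq_sum_range (fun t => z ^ t), geom_sum_eq hz1, hzT]
  simp

lemma sum_cos_fourier {T : ℕ} {k : ℤ} (hkT : |k| < T) :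
    ∑ t : Fin T, Real.cos (2 * Real.pi * (k : ℝ) * ((((t : ℕ) + 1 : ℕ) : ℝ) / T))
      = if k = 0 then (T : ℝ) else 0 := by
  split_ifs with hk
  · simp [hk]
  · have h := congrArg Complex.re (sum_exp_fourier_eq_zero hk hkT)
    rw [Complex.re_sum] at h
    simpa only [Complex.exp_ofReal_mul_I_re, Complex.zero_re] using h

lemma sum_sin_fourier {T : ℕ} {k : ℤ} (hkT : |k| < T) :
    ∑ t : Fin T, Real.sin (2 * Real.pi * (k : ℝ) * ((((t : ℕ) + 1 : ℕ) : ℝ) / T)) = 0 := by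
  by_cases hk : k = 0
  · simp [hk]
  · have h := congrArg Complex.im (sum_exp_fourier_eq_zero hk hkT)
    rw [Complex.im_sum] at h
    simpa only [Complex.exp_ofReal_mul_I_im, Complex.zero_im] using h

lemma sum_trigBasis_eq_zero {T K : ℕ} (hKT : 2 * K < T) (i : Fin 2 × Fin K) :
    ∑ t, trigBasis T K i t = 0 := by
  obtain ⟨r, l⟩ := i
  have hl := l.2
  have h : |((l : ℕ) + 1 : ℤ)| < T := by rw [abs_of_nonneg (by omega)]; omega
  have hc := sum_cos_fourier h
  have hs := sum_sin_fourier h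
  rw [if_neg (by omega)] at hc
  push_cast at hc hs
  simp only [trigBasis]
  push_cast
  split_ifs
  · exact hc
  · exact hs

/-- Product-to-sum formulas reduce everything to the sum and difference of the two frequencies. The
condition `2 * K < T` rules out aliasing: the sum is positive and below `T`, so only a zero
difference contributes. -/
lemma sum_trigBasis_mul {T K : ℕ} (hKT : 2 * K < T) (i k : Fin 2 × Fin K) :
    ∑ t, trigBasis T K i t * trigBasis T K k t = if i = k then (T : ℝ) / 2 else 0 := by
  obtain ⟨r, l⟩ := i
  obtain ⟨r', m⟩ := k
  have hl := l.2
  have hm := m.2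
  have hd : |(l : ℤ) - (m : ℤ)| < T := by rw [abs_lt]; omega
  have ha : |((l : ℤ) + 1) + ((m : ℤ) + 1)| < T := by rw [abs_of_nonneg (by omega)]; omega
  have cd := sum_cos_fourier hd
  have ca := sum_cos_fourier ha
  have sd := sum_sin_fourier hd
  have sa := sum_sin_fourier ha
  rw [if_neg (by omega)] at ca
  set θ : Fin T → ℝ := fun t => (((t : ℕ) + 1 : ℕ) : ℝ) / T with hθ
  have ed : ∀ t, 2 * Real.pi * (((l : ℤ) - (m : ℤ) : ℤ) : ℝ) * θ t
      = 2 * Real.pi * ((l : ℝ) + 1) * θ t - 2 * Real.pi * ((m : ℝ) + 1) * θ t := fun t => by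
    push_cast; ring
  have ea : ∀ t, 2 * Real.pi * (((l : ℤ) + 1 + ((m : ℤ) + 1) : ℤ) : ℝ) * θ t
      = 2 * Real.pi * ((l : ℝ) + 1) * θ t + 2 * Real.pi * ((m : ℝ) + 1) * θ t := fun t => by
    push_cast; ring
  change ∑ t, Real.cos (2 * Real.pi * (((l : ℤ) - (m : ℤ) : ℤ) : ℝ) * θ t) = _ at cd
  change ∑ t, Real.sin (2 * Real.pi * (((l : ℤ) - (m : ℤ) : ℤ) : ℝ) * θ t) = _ at sd
  change ∑ t, Real.cos (2 * Real.pi * (((l : ℤ) + 1 + ((m : ℤ) + 1) : ℤ) : ℝ) * θ t) = _ at ca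
  change ∑ t, Real.sin (2 * Real.pi * (((l : ℤ) + 1 + ((m : ℤ) + 1) : ℤ) : ℝ) * θ t) = _ at sa
  simp only [ed, Real.cos_sub, Finset.sum_add_distrib] at cd
  simp only [ea, Real.cos_add, Finset.sum_sub_distrib] at ca
  simp only [ed, Real.sin_sub, Finset.sum_sub_distrib] at sd
  simp only [ea, Real.sin_add, Finset.sum_add_distrib] at sa
  have hlm : ((l : ℤ) - (m : ℤ) = 0) ↔ l = m := by rw [Fin.ext_iff]; omega
  rw [if_congr hlm rfl rfl] at cd
  change ∑ t, (if r = 0 then Real.cos (2 * Real.pi * ((l : ℝ) + 1) * θ t)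
      else Real.sin (2 * Real.pi * ((l : ℝ) + 1) * θ t))
    * (if r' = 0 then Real.cos (2 * Real.pi * ((m : ℝ) + 1) * θ t)
      else Real.sin (2 * Real.pi * ((m : ℝ) + 1) * θ t)) = _
  have hr : ∀ q : Fin 2, q = 0 ∨ q = 1 := by decide
  rcases hr r with rfl | rfl <;> rcases hr r' with rfl | rfl
  · simp only [if_true, Prod.mk.injEq, true_and]
    split_ifs at cd ⊢ <;> linarith
  · simp only [if_true, one_ne_zero, if_false, Prod.mk.injEq, zero_ne_one, false_and]
    linarith
  · simp only [if_true, one_ne_zero, if_false, Prod.mk.injEq, false_and]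
    linarith
  · simp only [one_ne_zero, if_false, Prod.mk.injEq, true_and]
    split_ifs at cd ⊢ <;> linarith

/-- The trigonometric basis functions, scaled by `T^{-1/2}`. -/
def scaledBasis (T K : ℕ) (i : Fin 2 × Fin K) (t : Fin T) : ℝ := trigBasis T K i t / √(T : ℝ)

lemma abs_scaledBasis_le (T K : ℕ) (i : Fin 2 × Fin K) (t : Fin T) :
    |scaledBasis T K i t| ≤ 1 / √(T : ℝ) := by
  rw [scaledBasis, abs_div, abs_of_nonneg (Real.sqrt_nonneg _)]
  refine div_le_div_of_nonneg_right ?_ (Real.sqrt_nonneg _)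
  rw [trigBasis]
  split_ifs
  · exact Real.abs_cos_le_one _
  · exact Real.abs_sin_le_one _

lemma sum_scaledBasis_mul {T K : ℕ} (hKT : 2 * K < T) (i k : Fin 2 × Fin K) :
    ∑ t, scaledBasis T K i t * scaledBasis T K k t = if i = k then 1 / 2 else 0 := by
  have hT : (0 : ℝ) < T := by exact_mod_cast (Nat.zero_le _).trans_lt hKT
  have h : ∀ t, scaledBasis T K i t * scaledBasis T K k t
      = trigBasis T K i t * trigBasis T K k t / T := fun t => by
    rw [scaledBasis, scaledBasis, div_mul_div_comm, Real.mul_self_sqrt hT.le]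
  simp only [h]
  rw [← Finset.sum_div, sum_trigBasis_mul hKT]
  split_ifs
  · field_simp
  · simp

/-- The time points `1, …, T`. -/
def timePoint (T : ℕ) (t : Fin T) : ℤ := (((t : ℕ) + 1 : ℕ) : ℤ)

lemma timePoint_injective (T : ℕ) : Function.Injective (timePoint T) := fun s t h => by
  simp only [timePoint] at h
  exact Fin.ext (by omega)

/-- The trigonometric transform annihilates the mean. -/
lemma trigTransform_eq_linForm {Ω : Type*} {T K : ℕ} (hKT : 2 * K < T) {X : ℤ → Ω → ℝ} {m : ℝ}
    {d : Fin T → ℝ} {ω : Ω} (hd : ∀ t, d t = m + X (timePoint T t) ω) (i : Fin 2 × Fin K) :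
    trigTransform T K d i = linForm (timePoint T) X (scaledBasis T K i) ω := by
  have h0 := sum_trigBasis_eq_zero hKT i
  have e : ∑ t, (d t - (∑ s, d s) / T) * trigBasis T K i t
      = ∑ t, trigBasis T K i t * X (timePoint T t) ω
        + (m - (∑ s, d s) / T) * ∑ t, trigBasis T K i t := by
    rw [Finset.mul_sum, ← Finset.sum_add_distrib]
    exact Finset.sum_congr rfl fun t _ => by rw [hd]; ring
  rw [trigTransform, e, h0, mul_zero, add_zero, linForm, Finset.sum_div]
  exact Finset.sum_congr rfl fun t _ => by rw [scaledBasis]; ring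

/-! ### Consistency of the bootstrap variance -/

section Consistency

variable {Ω : Type*} [MeasurableSpace Ω] {P : Measure Ω}
  {X : ℤ → Ω → ℝ}

/-- The variance of the scaled sample mean. -/
def meanVariance (X : ℤ → Ω → ℝ) (P : Measure Ω) (T : ℕ) : ℝ :=
  (∑ s : Fin T, ∑ t : Fin T, autocov X P (timePoint T t - timePoint T s)) / T

lemma WeakDependence.variance_sampleMean [IsProbabilityMeasure P] (hX : WeakDependence X P)
    (hm : ∀ t, Measurable (X t))
    {y : ℕ → Ω → ℝ} {m : ℝ} (hY : ∀ t ω, y t ω = m + X (t : ℤ) ω) (T : ℕ) :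
    Var[fun ω => √(T : ℝ) * (sampleMean T (fun t => y t ω) - m); P] = meanVariance X P T := by
  have e : (fun ω => √(T : ℝ) * (sampleMean T (fun t => y t ω) - m))
      = linForm (timePoint T) X fun _ => 1 / √(T : ℝ) := by
    funext ω
    rw [sqrt_mul_sampleMean_sub hY, sum_Icc_one_eq_sum_fin T fun t => X (t : ℤ) ω, linForm,
      Finset.sum_div]
    exact Finset.sum_congr rfl fun t _ => by rw [timePoint]; ring
  have hlm : Measurable (linForm (timePoint T) X fun _ => 1 / √(T : ℝ)) := by
    unfold linForm; fun_prop
  have hi : ∀ t, Integrable (X t) P := fun t => (hX.stationary.memLp t).integrable (by norm_num)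
  have h0 : ∫ ω, linForm (timePoint T) X (fun _ => 1 / √(T : ℝ)) ω ∂P = 0 := by
    simp only [linForm]
    rw [integral_finsetSum _ fun t _ => (hi _).const_mul _]
    simp [integral_const_mul, hX.mean_zero]
  rw [e, variance_of_integral_eq_zero hlm.aemeasurable h0]
  simp only [pow_two]
  rw [hX.integral_linForm_mul, covForm, meanVariance, Finset.sum_div]
  refine Finset.sum_congr rfl fun s _ => ?_
  rw [Finset.sum_div]
  refine Finset.sum_congr rfl fun t _ => ?_
  rw [div_mul_div_comm, Real.mul_self_sqrt (Nat.cast_nonneg _)]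
  ring

/-- A linear bound suffices here and calls only for summability of `|h| |γ(h)|`. -/
lemma abs_one_sub_cos_le (x : ℝ) : |Real.cos x - 1| ≤ |x| := by
  have h1 := Real.one_sub_sq_div_two_le_cos (x := x)
  have h2 := Real.cos_le_one x
  have h3 := Real.neg_one_le_cos x
  rw [abs_of_nonpos (by linarith)]
  rcases le_or_gt |x| 2 with h | h
  · have := abs_nonneg x
    have := sq_abs x
    nlinarith
  · linarith

/-- At low frequencies the expected periodogram is close to the variance of the scaled sample
mean. -/
lemma WeakDependence.abs_covForm_scaledBasis_sub_le (hX : WeakDependence X P) {T K : ℕ}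
    (hT : 0 < T) (l : Fin K) :
    |covForm (timePoint T) X P (scaledBasis T K (0, l)) (scaledBasis T K (0, l))
        + covForm (timePoint T) X P (scaledBasis T K (1, l)) (scaledBasis T K (1, l))
        - meanVariance X P T|
      ≤ 2 * Real.pi * (K / T) * ∑' h : ℤ, |(h : ℝ)| * |autocov X P h| := by
  have hT' : (0 : ℝ) < T := by exact_mod_cast hT
  set θ : Fin T → ℝ := fun t => 2 * Real.pi * ((l : ℝ) + 1) * ((((t : ℕ) + 1 : ℕ) : ℝ) / T) with hθ
  have e0 : ∀ t, scaledBasis T K (0, l) t = Real.cos (θ t) / √(T : ℝ) := fun t => by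
    simp [scaledBasis, trigBasis, hθ]
  have e1 : ∀ t, scaledBasis T K (1, l) t = Real.sin (θ t) / √(T : ℝ) := fun t => by
    simp [scaledBasis, trigBasis, hθ]
  -- Adding the cosine and sine parts leaves the weight `cos (θ t - θ s)`, a function of the lag
  -- alone. The scaled sample mean has weight `1` in its place.
  have e : covForm (timePoint T) X P (scaledBasis T K (0, l)) (scaledBasis T K (0, l))
        + covForm (timePoint T) X P (scaledBasis T K (1, l)) (scaledBasis T K (1, l))
        - meanVariance X P T
      = (∑ s : Fin T, ∑ t : Fin T,
        (Real.cos (θ t - θ s) - 1) * autocov X P (timePoint T t - timePoint T s)) / T := by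
    simp only [covForm, meanVariance, Finset.sum_div, ← Finset.sum_add_distrib,
      ← Finset.sum_sub_distrib]
    refine Finset.sum_congr rfl fun s _ => Finset.sum_congr rfl fun t _ => ?_
    rw [e0, e0, e1, e1, div_mul_div_comm, div_mul_div_comm, Real.mul_self_sqrt hT'.le,
      Real.cos_sub]
    ring
  have hθd : ∀ s t, |θ t - θ s|
      ≤ 2 * Real.pi * (K / T) * |((timePoint T t - timePoint T s : ℤ) : ℝ)| := fun s t => by
    have : θ t - θ s = 2 * Real.pi * (((l : ℝ) + 1) / T)
        * ((timePoint T t - timePoint T s : ℤ) : ℝ) := by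
      simp only [hθ, timePoint]
      push_cast
      ring
    rw [this, abs_mul]
    refine mul_le_mul_of_nonneg_right ?_ (abs_nonneg _)
    rw [abs_of_nonneg (by positivity)]
    have hl : (l : ℝ) + 1 ≤ K := by exact_mod_cast l.2
    gcongr
  rw [e, abs_div, abs_of_pos hT', div_le_iff₀ hT']
  have hsum := sum_sum_sub_le (timePoint_injective T) hX.summable_abs_mul_autocov
    fun _ => by positivity
  rw [Fintype.card_fin] at hsum
  calc _ ≤ ∑ s : Fin T, ∑ t : Fin T, 2 * Real.pi * (K / T)
        * (|((timePoint T t - timePoint T s : ℤ) : ℝ)|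
          * |autocov X P (timePoint T t - timePoint T s)|) := by
        refine (Finset.abs_sum_le_sum_abs _ _).trans (Finset.sum_le_sum fun s _ => ?_)
        refine (Finset.abs_sum_le_sum_abs _ _).trans (Finset.sum_le_sum fun t _ => ?_)
        rw [abs_mul, ← mul_assoc]
        exact mul_le_mul_of_nonneg_right ((abs_one_sub_cos_le _).trans (hθd s t)) (abs_nonneg _)
    _ ≤ 2 * Real.pi * (K / T) * (T * ∑' h : ℤ, |(h : ℝ)| * |autocov X P h|) := by
        simp only [← Finset.mul_sum]
        exact mul_le_mul_of_nonneg_left hsum (by positivity)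
    _ = _ := by ring

/-- The expected bootstrap variance. -/
def expectedBootVariance (X : ℤ → Ω → ℝ) (P : Measure Ω) (T K : ℕ) : ℝ :=
  (∑ i, covForm (timePoint T) X P (scaledBasis T K i) (scaledBasis T K i)) / K

/-- The bound at a single frequency is uniform over the `K` frequencies, so it survives averaging.
Dividing by `K` although there are `2K` forms is right: each cosine–sine pair approximates the whole
variance. -/
lemma WeakDependence.abs_expectedBootVariance_sub_le (hX : WeakDependence X P) {T K : ℕ}
    (hT : 0 < T) (hK : 0 < K) :
    |expectedBootVariance X P T K - meanVariance X P T|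
      ≤ 2 * Real.pi * (K / T) * ∑' h : ℤ, |(h : ℝ)| * |autocov X P h| := by
  have hK' : (0 : ℝ) < K := by exact_mod_cast hK
  have e : expectedBootVariance X P T K - meanVariance X P T
      = (∑ l : Fin K,
        (covForm (timePoint T) X P (scaledBasis T K (0, l)) (scaledBasis T K (0, l))
          + covForm (timePoint T) X P (scaledBasis T K (1, l)) (scaledBasis T K (1, l))
          - meanVariance X P T)) / K := by
    rw [expectedBootVariance, Fintype.sum_prod_type, Fin.sum_univ_two, Finset.sum_sub_distrib,
      Finset.sum_add_distrib, Finset.sum_const, Finset.card_univ, Fintype.card_fin, nsmul_eq_mul]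
    field_simp
  rw [e, abs_div, abs_of_pos hK', div_le_iff₀ hK']
  refine (Finset.abs_sum_le_sum_abs _ _).trans ((Finset.sum_le_sum fun l _ =>
    hX.abs_covForm_scaledBasis_sub_le hT l).trans (le_of_eq ?_))
  rw [Finset.sum_const, Finset.card_univ, Fintype.card_fin, nsmul_eq_mul]
  ring

lemma one_div_sqrt_pow_four_mul {T : ℕ} (hT : 0 < T) (x : ℝ) :
    (1 / √(T : ℝ)) ^ 4 * (T * x) = x / T := by
  have hT' : (0 : ℝ) < T := by exact_mod_cast hT
  have h : √(T : ℝ) ^ 4 = T ^ 2 := by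
    rw [show (4 : ℕ) = 2 * 2 from rfl, pow_mul, Real.sq_sqrt hT'.le]
  rw [div_pow, h]
  field_simp

lemma one_div_sqrt_sq_mul {T : ℕ} (hT : 0 < T) (x : ℝ) : (1 / √(T : ℝ)) ^ 2 * (T * x) = x := by
  have hT' : (0 : ℝ) < T := by exact_mod_cast hT
  rw [div_pow, Real.sq_sqrt hT'.le]
  field_simp

/-- Mean square error of the bootstrap variance. -/
lemma WeakDependence.integral_bootVariance_sub_sq_le [IsProbabilityMeasure P]
    (hX : WeakDependence X P) {T K : ℕ} (hK : 0 < K) (hKT : 2 * K < T) (σ : ℝ) :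
    ∫ ω, ((∑ i, linForm (timePoint T) X (scaledBasis T K i) ω ^ 2) / K - σ) ^ 2 ∂P
      ≤ (expectedBootVariance X P T K - σ) ^ 2 + absAutocovSum X P ^ 2 / K
        + 4 * (absCumulantSum X P / T) := by
  have hT : 0 < T := by omega
  have hK' : (0 : ℝ) < K := by exact_mod_cast hK
  have hq := hX.integral_sum_linForm_sq_sq_le (timePoint T) (timePoint_injective T)
    (abs_scaledBasis_le T K) (sum_scaledBasis_mul hKT)
  simp only [Fintype.card_prod, Fintype.card_fin] at hq
  rw [one_div_sqrt_pow_four_mul hT] at hq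
  set S : Ω → ℝ := fun ω => ∑ i, linForm (timePoint T) X (scaledBasis T K i) ω ^ 2 with hS
  have i1 : Integrable S P := integrable_finsetSum _ fun i _ =>
    hX.integrable_linForm_sq (timePoint T) _
  have i2 : Integrable (fun ω => S ω ^ 2) P := by
    simp only [hS, pow_two (∑ i, _), Finset.sum_mul_sum]
    exact integrable_finsetSum _ fun i _ => integrable_finsetSum _ fun k _ =>
      hX.integrable_linForm_sq_mul_sq (timePoint T) _ _
  have m1 : ∫ ω, S ω ∂P = K * expectedBootVariance X P T K := by
    rw [hS, integral_finsetSum _ fun i _ => hX.integrable_linForm_sq (timePoint T) _,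
      expectedBootVariance, mul_div_cancel₀ _ hK'.ne']
    refine Finset.sum_congr rfl fun i _ => ?_
    rw [← hX.integral_linForm_mul]
    simp only [pow_two]
  have e : ∀ ω, (S ω / K - σ) ^ 2 = S ω ^ 2 / K ^ 2 - 2 * σ / K * S ω + σ ^ 2 := fun ω => by
    ring
  have hB : ∑ i, covForm (timePoint T) X P (scaledBasis T K i) (scaledBasis T K i)
      = K * expectedBootVariance X P T K := by
    rw [expectedBootVariance, mul_div_cancel₀ _ hK'.ne']
  rw [hB] at hq
  have hE : ∫ ω, (S ω / K - σ) ^ 2 ∂P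
      = (∫ ω, S ω ^ 2 ∂P) / K ^ 2 - 2 * σ / K * (K * expectedBootVariance X P T K) + σ ^ 2 := by
    simp only [e]
    have h1 := integral_add ((i2.div_const ((K : ℝ) ^ 2)).sub (i1.const_mul (2 * σ / K)))
      (integrable_const (μ := P) (σ ^ 2))
    have h2 := integral_sub (i2.div_const ((K : ℝ) ^ 2)) (i1.const_mul (2 * σ / K))
    simp only [Pi.sub_apply] at h1 h2
    rw [h1, h2, integral_div, integral_const_mul, m1]
    simp
  rw [hE]
  -- With `2K` forms, `2K · G²/2` over `K²` is `G²/K` and `(2K)² · S/T` over `K²` is `4 S/T`, for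
  -- `G` and `S` the autocovariance and cumulant sums.
  have h3 : (∫ ω, S ω ^ 2 ∂P) / K ^ 2 ≤ expectedBootVariance X P T K ^ 2
      + absAutocovSum X P ^ 2 / K + 4 * (absCumulantSum X P / T) := by
    rw [div_le_iff₀ (by positivity)]
    refine hq.trans (le_of_eq ?_)
    push_cast
    field_simp
    ring
  have h4 : 2 * σ / K * (K * expectedBootVariance X P T K)
      = 2 * σ * expectedBootVariance X P T K := by field_simp
  rw [h4]
  linarith

/-- The sum of the fourth powers of the bootstrap coefficients is of order `1 / K`. -/
lemma WeakDependence.integral_sum_linForm_pow_four_le (hX : WeakDependence X P) {T K : ℕ}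
    (hK : 0 < K) (hKT : 2 * K < T) :
    ∫ ω, (∑ i, linForm (timePoint T) X (scaledBasis T K i) ω ^ 4) / K ^ 2 ∂P
      ≤ (6 * absAutocovSum X P ^ 2 + 2 * absCumulantSum X P) / K := by
  have hT : 0 < T := by omega
  have hT1 : (1 : ℝ) ≤ T := by exact_mod_cast hT
  have hK' : (0 : ℝ) < K := by exact_mod_cast hK
  have hi := fun i => hX.integrable_linForm_sq_mul_sq (timePoint T) (scaledBasis T K i)
    (scaledBasis T K i)
  have e : ∀ i ω, linForm (timePoint T) X (scaledBasis T K i) ω ^ 4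
      = linForm (timePoint T) X (scaledBasis T K i) ω ^ 2
        * linForm (timePoint T) X (scaledBasis T K i) ω ^ 2 := fun i ω => by ring
  have hterm : ∀ i, ∫ ω, linForm (timePoint T) X (scaledBasis T K i) ω ^ 2
        * linForm (timePoint T) X (scaledBasis T K i) ω ^ 2 ∂P
      -- With equal coefficients the three Gaussian pairings coincide, giving three times the
      -- squared variance.
      ≤ 3 * absAutocovSum X P ^ 2 + absCumulantSum X P := fun i => by
    have h1 := (abs_le.1 (hX.abs_integral_linForm_sq_mul_sq_sub_le (timePoint T)
      (timePoint_injective T) (abs_scaledBasis_le T K i) (abs_scaledBasis_le T K i))).2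
    have h2 := hX.abs_covForm_le (timePoint T) (timePoint_injective T)
      (abs_scaledBasis_le T K i) (abs_scaledBasis_le T K i)
    rw [Fintype.card_fin, one_div_sqrt_pow_four_mul hT] at h1
    rw [Fintype.card_fin, one_div_sqrt_sq_mul hT] at h2
    have h3 : absCumulantSum X P / T ≤ absCumulantSum X P :=
      div_le_self absCumulantSum_nonneg hT1
    have h4 := sq_le_sq' (neg_le_of_abs_le h2) (le_of_abs_le h2)
    linarith
  simp only [e]
  rw [integral_div, integral_finsetSum _ fun i _ => hi i, div_le_div_iff₀ (by positivity) hK']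
  have hs := Finset.sum_le_sum fun i (_ : i ∈ Finset.univ) => hterm i
  rw [Finset.sum_const, Finset.card_univ, Fintype.card_prod, Fintype.card_fin, Fintype.card_fin,
    nsmul_eq_mul] at hs
  push_cast at hs
  nlinarith

end Consistency

/-! ### Probability bounds for the coefficients, and the conditional law -/

section Bootstrap

variable {Ω : Type*} [MeasurableSpace Ω] {P : Measure Ω} {X : ℤ → Ω → ℝ}

/-- Chebyshev's inequality about the target `σ` itself, so that bias and variance are handled
together. -/
lemma WeakDependence.measureReal_bootVariance_ge_le [IsProbabilityMeasure P]
    (hX : WeakDependence X P) {T K : ℕ}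
    (hK : 0 < K) (hKT : 2 * K < T) (σ : ℝ) {δ : ℝ} (hδ : 0 < δ) :
    P.real {ω | δ ≤ |(∑ i, linForm (timePoint T) X (scaledBasis T K i) ω ^ 2) / K - σ|}
      ≤ ((expectedBootVariance X P T K - σ) ^ 2 + absAutocovSum X P ^ 2 / K
        + 4 * (absCumulantSum X P / T)) / δ ^ 2 := by
  have i1 : Integrable (fun ω => ∑ i, linForm (timePoint T) X (scaledBasis T K i) ω ^ 2) P :=
    integrable_finsetSum _ fun i _ => hX.integrable_linForm_sq (timePoint T) _
  have i2 : Integrable (fun ω => (∑ i, linForm (timePoint T) X (scaledBasis T K i) ω ^ 2) ^ 2) P := by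
    simp only [pow_two (∑ i, _), Finset.sum_mul_sum]
    exact integrable_finsetSum _ fun i _ => integrable_finsetSum _ fun k _ =>
      hX.integrable_linForm_sq_mul_sq (timePoint T) _ _
  have hi : Integrable (fun ω =>
      ((∑ i, linForm (timePoint T) X (scaledBasis T K i) ω ^ 2) / K - σ) ^ 2) P := by
    refine (((i2.div_const ((K : ℝ) ^ 2)).sub (i1.const_mul (2 * σ / K))).add
      (integrable_const (σ ^ 2))).congr (Eventually.of_forall fun ω => ?_)
    simp only [Pi.add_apply, Pi.sub_apply]
    ring
  have h := mul_meas_ge_le_integral_of_nonneg (Eventually.of_forall fun ω => sq_nonneg _) hi (δ ^ 2)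
  rw [le_div_iff₀ (by positivity), mul_comm]
  refine le_trans (le_of_eq ?_) (h.trans (hX.integral_bootVariance_sub_sq_le hK hKT σ))
  congr 2
  ext ω
  simp only [Set.mem_ofPred_eq]
  rw [← sq_abs (_ - σ), pow_le_pow_iff_left₀ hδ.le (abs_nonneg _) two_ne_zero]

lemma WeakDependence.measureReal_sum_pow_four_ge_le (hX : WeakDependence X P) {T K : ℕ}
    (hK : 0 < K) (hKT : 2 * K < T) {δ : ℝ} (hδ : 0 < δ) :
    P.real {ω | δ ≤ (∑ i, linForm (timePoint T) X (scaledBasis T K i) ω ^ 4) / K ^ 2}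
      ≤ (6 * absAutocovSum X P ^ 2 + 2 * absCumulantSum X P) / K / δ := by
  have hi : Integrable (fun ω =>
      (∑ i, linForm (timePoint T) X (scaledBasis T K i) ω ^ 4) / (K : ℝ) ^ 2) P := by
    refine (integrable_finsetSum _ fun i _ => ?_).div_const _
    refine (hX.integrable_linForm_sq_mul_sq (timePoint T) (scaledBasis T K i)
      (scaledBasis T K i)).congr (Eventually.of_forall fun ω => ?_)
    simp only
    ring
  have h := mul_meas_ge_le_integral_of_nonneg (Eventually.of_forall fun ω => by positivity) hi δ
  rw [le_div_iff₀ hδ, mul_comm]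
  exact h.trans (hX.integral_sum_linForm_pow_four_le hK hKT)

/-- The conditional law of the bootstrap statistic given the data is that of a weighted sum of the
external weights, with the trigonometric transforms of the data as coefficients. -/
lemma condDistrib_bootstrapStat [IsProbabilityMeasure P] {T : Fin 2 → ℕ} {Y : Fin 2 → ℕ → Ω → ℝ}
    (hY : ∀ i t, Measurable (Y i t)) (j : Fin 2) {K : ℕ} (hT : 0 < T j)
    {V : Fin 2 × Fin K → Ω → ℝ} (hV : ∀ i, Measurable (V i))
    (hind : IndepFun (dataSample T Y) (fun ω i => V i ω) P) :
    ∀ᵐ ω ∂P, condDistrib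
        (fun ω' => bootstrapStat T (fun i t => Y i t ω') j K (fun i => V i ω'))
        (dataSample T Y) P (dataSample T Y ω)
      = P.map fun ω' => ∑ i,
        trigTransform (T j) K (fun t => Y j ((t : ℕ) + 1) ω) i / √(K : ℝ) * V i ω' := by
  have hd : Measurable (dataSample T Y) :=
    measurable_pi_lambda _ fun i => measurable_pi_lambda _ fun t => hY i _
  let Φ : ((i : Fin 2) → Fin (T i) → ℝ) → (Fin 2 × Fin K → ℝ) → ℝ := fun d w =>
    ∑ i, trigTransform (T j) K (d j) i / √(K : ℝ) * w i
  have hΦ : Measurable (Function.uncurry Φ) := by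
    refine Finset.measurable_fun_sum _ fun i _ => ?_
    refine Measurable.mul (Measurable.div_const ?_ _)
      ((measurable_pi_apply i).comp measurable_snd)
    exact (measurable_trigTransform (T j) K i).comp ((measurable_pi_apply j).comp measurable_fst)
  have hstat : (fun ω' => bootstrapStat T (fun i t => Y i t ω') j K (fun i => V i ω'))
      = fun ω' => Φ (dataSample T Y ω') fun i => V i ω' :=
    funext fun ω' => bootstrapStat_eq_sum T _ j K hT _
  rw [hstat]
  exact condDistrib_ae_eq_map_of_indepFun hd (measurable_pi_lambda _ hV) hind hΦ

end Bootstrap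

end SeriesHAR

end

/-! ### Assembling the main theorem -/

theorem theorem3
    {Ω Ω' : Type*} [MeasurableSpace Ω] [MeasurableSpace Ω']
    (P : Measure Ω) [IsProbabilityMeasure P] (P' : Measure Ω') [IsProbabilityMeasure P']
    -- the two series `Y_{jt} = μ_j + u_{jt}`, with independent errors
    (u : Fin 2 → ℤ → Ω → ℝ) (hu_meas : ∀ j t, Measurable (u j t))
    (hu_indep : iIndepFun (fun j ω t => u j t ω) P)
    (μ : Fin 2 → ℝ) (Y : Fin 2 → ℕ → Ω → ℝ)
    (hY : ∀ j t ω, Y j t ω = μ j + u j (t : ℤ) ω)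
    -- the long-run variances
    (LRV : Fin 2 → ℝ) (hLRV : ∀ j, SeriesHAR.IsLongRunVariance (Y j) (μ j) P (LRV j))
    (hLRV_pos : ∀ j, 0 < LRV j)
    -- functional central limit theorem
    (W : Fin 2 → ℝ≥0 → Ω' → ℝ) (hW : SeriesHAR.IsStandardBrownian₂ W P')
    (hFCLT : SeriesHAR.FunctionalCLT u P LRV W P')
    -- stationarity and weak dependence
    (hdep : ∀ j, SeriesHAR.WeakDependence (u j) P)
    -- sample sizes and numbers of bootstrap basis functions
    (T K : ℕ → Fin 2 → ℕ)
    (hT : ∀ j, Tendsto (fun n => T n j) atTop atTop)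
    (hK : ∀ j, Tendsto (fun n => K n j) atTop atTop)
    (hKT : ∀ j, Tendsto (fun n => (K n j : ℝ) / (T n j : ℝ)) atTop (𝓝 0))
    -- i.i.d. bootstrap weights, independent of the data, with bounded fourth moments
    (v : (n : ℕ) → (j : Fin 2) → Fin 2 × Fin (K n j) → Ω → ℝ)
    (hv_meas : ∀ n j i, Measurable (v n j i))
    (hv_indep : ∀ n j, iIndepFun (v n j) P)
    (hv_ident : ∀ n j i i', IdentDistrib (v n j i) (v n j i') P P)
    (hv_data : ∀ n j, IndepFun (SeriesHAR.dataSample (T n) Y) (fun ω i => v n j i ω) P)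
    (hv_mean : ∀ n j i, ∫ ω, v n j i ω ∂P = 0)
    (hv_var : ∀ n j i, Var[v n j i; P] = 1)
    (C : ℝ)
    (hv_four : ∀ n j i, MemLp (v n j i) 4 P ∧ ∫ ω, v n j i ω ^ 4 ∂P < C) :
    ∀ j, TendstoInMeasure P
      (fun n ω => ⨆ x : ℝ,
        |(condDistrib
            (fun ω' => SeriesHAR.bootstrapStat (T n) (fun i t => Y i t ω') j (K n j)
              (fun i => v n j i ω'))
            (SeriesHAR.dataSample (T n) Y) P (SeriesHAR.dataSample (T n) Y ω)).real (Set.Iio x)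
          - P.real {ω' | √(T n j : ℝ) *
              (SeriesHAR.sampleMean (T n j) (fun t => Y j t ω') - μ j) < x}|)
      atTop (fun _ => (0 : ℝ)) := by
  intro j
  have hYm : ∀ i t, Measurable (Y i t) := fun i t => by
    have : Y i t = fun ω => μ i + u i (t : ℤ) ω := funext (hY i t)
    rw [this]
    exact (hu_meas i t).const_add _
  have hX := hdep j
  have hV : ∀ n, SeriesHAR.IsWeightFamily (v n j) P (max C 0) := fun n =>
    ⟨hv_meas n j, hv_indep n j, hv_mean n j, hv_var n j, fun i => (hv_four n j i).1,
      fun i => (hv_four n j i).2.le.trans (le_max_left _ _)⟩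
  have hσ : (LRV j).toNNReal ≠ 0 := (Real.toNNReal_pos.2 (hLRV_pos j)).ne'
  have hσc : ((LRV j).toNNReal : ℝ) = LRV j := Real.coe_toNNReal _ (hLRV_pos j).le
  have hT' : Tendsto (fun n => (T n j : ℝ)) atTop atTop :=
    tendsto_natCast_atTop_atTop.comp (hT j)
  have hK' : Tendsto (fun n => (K n j : ℝ)) atTop atTop :=
    tendsto_natCast_atTop_atTop.comp (hK j)
  have hKpos : ∀ᶠ n in atTop, 0 < K n j := (hK j).eventually_gt_atTop 0
  have hKTlt : ∀ᶠ n in atTop, 2 * K n j < T n j := by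
    -- Positivity of `T` is required separately: for `T = 0` the quotient is `0` by convention and
    -- says nothing about `K`.
    filter_upwards [(hKT j).eventually (gt_mem_nhds (show (0 : ℝ) < 1 / 2 by norm_num)),
      (hT j).eventually_gt_atTop 0] with n hn hTn
    rw [div_lt_iff₀ (by exact_mod_cast hTn)] at hn
    have : (2 * K n j : ℝ) < T n j := by linarith
    exact_mod_cast this
  have hmean : Tendsto (fun n => SeriesHAR.meanVariance (u j) P (T n j)) atTop (𝓝 (LRV j)) := by
    have := (hLRV j).comp (hT j)
    refine this.congr fun n => ?_
    exact hX.variance_sampleMean (hu_meas j) (hY j) (T n j)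
  have hboot : Tendsto (fun n => SeriesHAR.expectedBootVariance (u j) P (T n j) (K n j)) atTop
      (𝓝 (LRV j)) := by
    have h0 : Tendsto (fun n => SeriesHAR.expectedBootVariance (u j) P (T n j) (K n j)
        - SeriesHAR.meanVariance (u j) P (T n j)) atTop (𝓝 0) := by
      refine squeeze_zero_norm' (a := fun n => 2 * Real.pi * ((K n j : ℝ) / T n j)
        * ∑' h : ℤ, |(h : ℝ)| * |SeriesHAR.autocov (u j) P h|) ?_ ?_
      · filter_upwards [hKpos, hKTlt] with n h1 h2
        exact hX.abs_expectedBootVariance_sub_le (by omega) h1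
      · simpa using ((hKT j).const_mul (2 * Real.pi)).mul_const
          (∑' h : ℤ, |(h : ℝ)| * |SeriesHAR.autocov (u j) P h|)
    simpa using h0.add hmean
  rw [tendstoInMeasure_iff_measureReal_dist]
  intro ε hε
  -- Each of the two laws gets an error `ε/3` from the Gaussian, so their distance is at most
  -- `2ε/3`, strictly below `ε`.
  obtain ⟨δ, hδ, happrox⟩ := SeriesHAR.exists_weightedSum_approx (le_max_right C 0) hV hσ
    (show 0 < ε / 3 by positivity)
  have hcdf := (hT j).eventually (Metric.tendstoUniformly_iff.1
    (SeriesHAR.tendstoUniformly_sampleMean hu_meas hW hFCLT j (hLRV_pos j)) (ε / 3)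
    (by positivity))
  have hbound : Tendsto (fun n =>
      ((SeriesHAR.expectedBootVariance (u j) P (T n j) (K n j) - LRV j) ^ 2
        + SeriesHAR.absAutocovSum (u j) P ^ 2 / (K n j : ℝ)
        + 4 * (SeriesHAR.absCumulantSum (u j) P / (T n j : ℝ))) / δ ^ 2
      + (6 * SeriesHAR.absAutocovSum (u j) P ^ 2 + 2 * SeriesHAR.absCumulantSum (u j) P)
        / (K n j : ℝ) / δ) atTop (𝓝 0) := by
    have h1 := (hboot.sub_const (LRV j)).pow 2
    have h2 := hK'.const_div_atTop (SeriesHAR.absAutocovSum (u j) P ^ 2)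
    have h3 := (hT'.const_div_atTop (SeriesHAR.absCumulantSum (u j) P)).const_mul 4
    have h4 := (hK'.const_div_atTop
      (6 * SeriesHAR.absAutocovSum (u j) P ^ 2 + 2 * SeriesHAR.absCumulantSum (u j) P)).div_const δ
    simpa using (((h1.add h2).add h3).div_const (δ ^ 2)).add h4
  refine squeeze_zero' (Eventually.of_forall fun _ => measureReal_nonneg) ?_ hbound
  filter_upwards [hKpos, hKTlt, hcdf] with n hKn hKTn hcdfn
  have hTn : 0 < T n j := by omega
  have hKr : (0 : ℝ) ≤ K n j := Nat.cast_nonneg _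
  refine le_trans ?_ (add_le_add
    (hX.measureReal_bootVariance_ge_le hKn hKTn (LRV j) hδ)
    (hX.measureReal_sum_pow_four_ge_le hKn hKTn hδ))
  refine le_trans ?_ (measureReal_union_le _ _)
  -- The bad event is contained in the union of the two coefficient events only almost surely, since
  -- the conditional law is identified only almost everywhere.
  refine ENNReal.toReal_mono (measure_ne_top _ _) (measure_mono_ae ?_)
  filter_upwards [SeriesHAR.condDistrib_bootstrapStat hYm j hTn (hv_meas n j) (hv_data n j)]
    with ω hω hbad
  by_contra hgood
  change ¬ (_ ∨ _) at hgood
  simp only [Set.mem_ofPred_eq, not_or, not_le] at hgood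
  have htr := fun i => SeriesHAR.trigTransform_eq_linForm hKTn (X := u j) (m := μ j)
    (d := fun t => Y j ((t : ℕ) + 1) ω) (ω := ω) (fun t => hY j _ ω) i
  have hsq : ∑ i, (SeriesHAR.trigTransform (T n j) (K n j) (fun t => Y j ((t : ℕ) + 1) ω) i
        / √(K n j : ℝ)) ^ 2
      = (∑ i, SeriesHAR.linForm (SeriesHAR.timePoint (T n j)) (u j)
        (SeriesHAR.scaledBasis (T n j) (K n j) i) ω ^ 2) / K n j := by
    rw [Finset.sum_div]
    refine Finset.sum_congr rfl fun i _ => ?_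
    rw [htr, div_pow, Real.sq_sqrt hKr]
  have hfour : ∑ i, (SeriesHAR.trigTransform (T n j) (K n j) (fun t => Y j ((t : ℕ) + 1) ω) i
        / √(K n j : ℝ)) ^ 4
      = (∑ i, SeriesHAR.linForm (SeriesHAR.timePoint (T n j)) (u j)
        (SeriesHAR.scaledBasis (T n j) (K n j) i) ω ^ 4) / (K n j : ℝ) ^ 2 := by
    rw [Finset.sum_div]
    refine Finset.sum_congr rfl fun i _ => ?_
    have h4 : √(K n j : ℝ) ^ 4 = (K n j : ℝ) ^ 2 := by
      rw [show (4 : ℕ) = 2 * 2 from rfl, pow_mul, Real.sq_sqrt hKr]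
    rw [htr, div_pow, h4]
  -- The data at `ω` are frozen here: their transforms serve as deterministic coefficients, which is
  -- why the approximation had to be uniform in `c`.
  have hx := happrox n _ (by rw [hsq, hσc]; exact hgood.1) (by rw [hfour]; exact hgood.2)
  have hstat : ∀ x : ℝ, P.real {ω' | √(T n j : ℝ) *
        (SeriesHAR.sampleMean (T n j) (fun t => Y j t ω') - μ j) < x}
      = (P.map fun ω' => (∑ t ∈ Finset.Icc 1 (T n j), u j (t : ℤ) ω') / √(T n j : ℝ)).real
        (Set.Iio x) := fun x => by
    have hm : Measurable fun ω' => (∑ t ∈ Finset.Icc 1 (T n j), u j (t : ℤ) ω') / √(T n j : ℝ) := by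
      have := hu_meas j
      fun_prop
    rw [map_measureReal_apply hm measurableSet_Iio]
    congr 1
    ext ω'
    simp only [Set.mem_ofPred_eq, Set.mem_preimage, Set.mem_Iio]
    rw [SeriesHAR.sqrt_mul_sampleMean_sub (hY j)]
  have hsup : (⨆ x : ℝ,
      |(condDistrib
            (fun ω' => SeriesHAR.bootstrapStat (T n) (fun i t => Y i t ω') j (K n j)
              (fun i => v n j i ω'))
            (SeriesHAR.dataSample (T n) Y) P (SeriesHAR.dataSample (T n) Y ω)).real (Set.Iio x)
          - P.real {ω' | √(T n j : ℝ) *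
              (SeriesHAR.sampleMean (T n j) (fun t => Y j t ω') - μ j) < x}|) ≤ 2 * ε / 3 := by
    refine Real.iSup_le (fun x => ?_) (by positivity)
    rw [hω, hstat x]
    have h1 := hx x
    have h2 := hcdfn x
    rw [Real.dist_eq] at h2
    rw [abs_lt] at h1 h2
    rw [abs_le]
    constructor <;> linarith
  change ε ≤ dist _ (0 : ℝ) at hbad
  rw [Real.dist_eq, sub_zero, abs_of_nonneg (Real.iSup_nonneg fun x => abs_nonneg _)] at hbad
  linarith
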